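/- Let $N\ge 1$, let $\Omega\subset\mathbb R^N$ be open and bounded, and let $1<p<\infty$, $0<s<1$, $A>0$, $C\in\mathbb R$, $p'=p/(p-1)$. Write $W^{s,p}(\mathbb R^N)$ for the space of functions with finite norm $\|w\|_{L^p}+[w]$, where $[w]^p=\iint_{\mathbb R^N\times\mathbb R^N}\frac{|w(x)-w(y)|^p}{|x-y|^{N+sp}}\,dx\,dy$, and $W^{s,p}_0(\Omega)$ for the subspace of $W^{s,p}(\mathbb R^N)$ of the functions that vanish a.e. outside $\Omega$. Let $H:\mathbb R^N\times\mathbb R^N\times\mathbb R\to\mathbb R$ be a Carathéodory function (measurable in $(x,y)$, continuous in $\xi$) such that, for a.e. $(x,y)$, the function $\xi\mapsto H(x,y,\xi)$ is convex and $C^1$ and $$A\Big(\frac{|\xi|}{|x-y|^s}\Big)^p\le H(x,y,\xi)\le C\Big(\frac{|\xi|}{|x-y|^s}\Big)^p\qquad\text{for all }\xi\in\mathbb R .$$ Put $\mathcal E(w)=\iint_{\mathbb R^N\times\mathbb R^N}\frac{H(x,y,w(x)-w(y))}{|x-y|^N}\,dx\,dy\in[0,\infty]$. Let $u_0\in W^{s,p}(\mathbb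 R^N)$ with $u_0|_\Omega\in L^2(\Omega)$ and $\mathcal E(u_0)<\infty$. Let $u$ be a variational solution with data $u_0$ of $$\partial_t u+\mathrm{P.V.}\int_{\mathbb R^N}\frac{\partial_\xi H(x,y,u(x,t)-u(y,t))}{|x-y|^N}\,dy=0\ \text{ in }\Omega\times(0,\infty),\qquad u=u_0\ \text{ on }(\mathbb R^N\setminus\Omega)\times(0,\infty)\,\cup\,\Omega\times\{0\};$$ that is, for every $T>0$, $u\in L^p(0,T;W^{s,p}(\mathbb R^N))\cap C([0,T];L^2(\Omega))$, $u-u_0\in L^p(0,T;W^{s,p}_0(\Omega))$, and $$\int_0^T\!\mathcal E(u(t))\,dt\le\int_0^T\!\mathcal E(v(t))\,dt+\int_0^T\!\!\int_\Omega\partial_t v\,(v-u)\,dx\,dt+\tfrac12\|v(\cdot,0)-u_0\|_{L^2(\Omega)}^2-\tfrac12\|v(\cdot,T)-u(\cdot,T)\|_{L^2(\Omega)}^2$$ for all $v\in L^p(0,T;W^{s,p}(\mathbb R^N))\cap C([0,T];L^2(\Omega))$ with $v-u_0\in L^p(0,T;W^{s,p}_0(\Omega))$ and weak derivative $\partial_t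 v\in L^2(\Omega\times(0,T))$. Then, for every $T>0$: 1. $\partial_t u\in L^{p'}(0,T;(W^{s,p}_0(\Omega))^*)$, that is, there is $F\in L^{p'}(0,T;(W^{s,p}_0(\Omega))^*)$ such that for every $w\in W^{s,p}_0(\Omega)\cap L^2(\Omega)$ the function $t\mapsto\langle F(t),w\rangle$ is the distributional derivative of $t\mapsto\int_\Omega u(x,t)w(x)\,dx$ on $(0,T)$; one writes $\partial_t u=F$. 2. $u$ is a weak solution on $(0,T)$: $u\in L^p(0,T;W^{s,p}(\mathbb R^N))\cap C([0,T];L^2(\Omega))$, $u-u_0\in L^p(0,T;W^{s,p}_0(\Omega))$, $u(\cdot,0)=u_0$ a.e. in $\Omega$, $\partial_t u\in L^{p'}(0,T;(W^{s,p}_0(\Omega))^*)$, and for every $\tau\in(0,T]$ and every $\phi\in C_0^\infty(\Omega\times(0,\tau))$ both integrals below converge absolutely and $$\int_0^\tau\!\!\iint_{\mathbb R^N\times\mathbb R^N}\frac{\partial_\xi H(x,y,u(x,t)-u(y,t))\,(\phi(x,t)-\phi(y,t))}{|x-y|^N}\,dx\,dy\,dt+\int_0^\tau\langle\partial_t u(t),\phi(\cdot,t)\rangle\,dt=0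 .$$ -/

import Mathlib

open MeasureTheory Set Filter Topology
open scoped ENNReal ContDiff

noncomputable section

namespace NonlocalEvolution

/-- Euclidean space `ℝ^N`. -/
abbrev Sp (N : ℕ) : Type := EuclideanSpace ℝ (Fin N)

variable {N : ℕ}

/-! ### Fractional Sobolev spaces -/

/-- The weighted difference `(w x - w y) / |x - y| ^ (N / p + s)`. The integral over `ℝ^N × ℝ^N` of
the `p`-th power of its modulus is the integral of `|w x - w y| ^ p / |x - y| ^ (N + s p)`. -/
def diffQuot (s p : ℝ) (w : Sp N → ℝ) (z : Sp N × Sp N) : ℝ :=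
  (w z.1 - w z.2) / ‖z.1 - z.2‖ ^ ((N : ℝ) / p + s)

/-- The Gagliardo seminorm `[w]` of `W^{s,p}(ℝ^N)`, with values in `[0, ∞]`. -/
def gagliardo (s p : ℝ) (w : Sp N → ℝ) : ℝ≥0∞ :=
  eLpNorm (diffQuot s p w) (ENNReal.ofReal p) volume

/-- The norm `‖w‖_{L^p} + [w]` of `W^{s,p}(ℝ^N)`, with values in `[0, ∞]`. -/
def sobolevENorm (s p : ℝ) (w : Sp N → ℝ) : ℝ≥0∞ :=
  eLpNorm w (ENNReal.ofReal p) volume + gagliardo s p w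

/-- Membership in `W^{s,p}(ℝ^N)`. -/
def MemW (s p : ℝ) (w : Sp N → ℝ) : Prop :=
  AEStronglyMeasurable w volume ∧ sobolevENorm s p w < ⊤

lemma diffQuot_add (s p : ℝ) (v w : Sp N → ℝ) :
    diffQuot s p (v + w) = diffQuot s p v + diffQuot s p w := by
  funext z
  simp only [diffQuot, Pi.add_apply]
  ring

lemma diffQuot_smul (s p c : ℝ) (w : Sp N → ℝ) :
    diffQuot s p (c • w) = c • diffQuot s p w := by
  funext z
  simp only [diffQuot, Pi.smul_apply, smul_eq_mul]
  ring

lemma aestronglyMeasurable_diffQuot (s p : ℝ) {w : Sp N → ℝ}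
    (hw : AEStronglyMeasurable w volume) : AEStronglyMeasurable (diffQuot s p w) volume := by
  have h1 : AEStronglyMeasurable (fun z : Sp N × Sp N => w z.1) volume := hw.comp_fst
  have h2 : AEStronglyMeasurable (fun z : Sp N × Sp N => w z.2) volume := hw.comp_snd
  have h3 : Measurable (fun z : Sp N × Sp N => ‖z.1 - z.2‖ ^ ((N : ℝ) / p + s)) := by fun_prop
  exact ((h1.sub h2).aemeasurable.div h3.aemeasurable).aestronglyMeasurable

lemma memW_iff (s p : ℝ) (w : Sp N → ℝ) :
    MemW s p w ↔ MemLp w (ENNReal.ofReal p) volume ∧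
      MemLp (diffQuot s p w) (ENNReal.ofReal p) volume := by
  constructor
  · rintro ⟨h1, h2⟩
    rw [sobolevENorm, gagliardo, ENNReal.add_lt_top] at h2
    exact ⟨⟨h1, h2.1⟩, ⟨aestronglyMeasurable_diffQuot s p h1, h2.2⟩⟩
  · rintro ⟨h1, h2⟩
    exact ⟨h1.1, ENNReal.add_lt_top.2 ⟨h1.2, h2.2⟩⟩

/-- The functions of `W^{s,p}(ℝ^N)` that vanish (almost everywhere) outside `Ω`. -/
def sobolevZero (Ω : Set (Sp N)) (s p : ℝ) : Submodule ℝ (Sp N → ℝ) where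
  carrier := {w | MemW s p w ∧ ∀ᵐ x, x ∉ Ω → w x = 0}
  zero_mem' := by
    refine ⟨(memW_iff s p _).2 ⟨MemLp.zero, ?_⟩, by simp⟩
    have h : diffQuot s p (0 : Sp N → ℝ) = 0 := by
      funext z
      simp [diffQuot]
    rw [h]
    exact MemLp.zero
  add_mem' := by
    rintro v w ⟨hv, hv0⟩ ⟨hw, hw0⟩
    rw [memW_iff] at hv hw
    refine ⟨(memW_iff s p _).2 ⟨hv.1.add hw.1, ?_⟩, ?_⟩
    · rw [diffQuot_add]
      exact hv.2.add hw.2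
    · filter_upwards [hv0, hw0] with x h1 h2 hx
      simp [h1 hx, h2 hx]
  smul_mem' := by
    rintro c w ⟨hw, hw0⟩
    rw [memW_iff] at hw
    refine ⟨(memW_iff s p _).2 ⟨hw.1.const_smul c, ?_⟩, ?_⟩
    · rw [diffQuot_smul]
      exact hw.2.const_smul c
    · filter_upwards [hw0] with x h1 hx
      simp [h1 hx]

/-- The space `W^{s,p}_0(Ω)`, a type of functions `ℝ^N → ℝ` that carries the norm of `W^{s,p}(ℝ^N)`.
Functions that agree almost everywhere are at distance zero and are not identified; the space of
continuous linear functionals is the same as that of the quotient. -/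
def W0 (Ω : Set (Sp N)) (s p : ℝ) : Type := sobolevZero Ω s p

instance (Ω : Set (Sp N)) (s p : ℝ) : AddCommGroup (W0 Ω s p) :=
  inferInstanceAs (AddCommGroup (sobolevZero Ω s p))

instance (Ω : Set (Sp N)) (s p : ℝ) : Module ℝ (W0 Ω s p) :=
  inferInstanceAs (Module ℝ (sobolevZero Ω s p))

instance (Ω : Set (Sp N)) (s p : ℝ) : CoeFun (W0 Ω s p) (fun _ => Sp N → ℝ) :=
  ⟨fun w => Subtype.val w⟩

instance (Ω : Set (Sp N)) (s p : ℝ) : Norm (W0 Ω s p) :=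
  ⟨fun w => (sobolevENorm s p (w : Sp N → ℝ)).toReal⟩

lemma W0.core (Ω : Set (Sp N)) (s p : ℝ) [hp : Fact (1 < p)] :
    SeminormedSpace.Core ℝ (W0 Ω s p) where
  norm_nonneg _ := ENNReal.toReal_nonneg
  norm_smul c w := by
    change (sobolevENorm s p (c • (w : Sp N → ℝ))).toReal
      = ‖c‖ * (sobolevENorm s p (w : Sp N → ℝ)).toReal
    rw [sobolevENorm, sobolevENorm, gagliardo, gagliardo, diffQuot_smul, eLpNorm_const_smul,
      eLpNorm_const_smul, ← mul_add, ENNReal.toReal_mul]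
    simp
  norm_triangle v w := by
    change (sobolevENorm s p ((v : Sp N → ℝ) + (w : Sp N → ℝ))).toReal
      ≤ (sobolevENorm s p (v : Sp N → ℝ)).toReal + (sobolevENorm s p (w : Sp N → ℝ)).toReal
    have hv : MemW s p (v : Sp N → ℝ) := (Subtype.property v).1
    have hw : MemW s p (w : Sp N → ℝ) := (Subtype.property w).1
    have h1 : 1 ≤ ENNReal.ofReal p := by
      rw [ENNReal.one_le_ofReal]
      exact hp.out.le
    rw [← ENNReal.toReal_add hv.2.ne hw.2.ne]
    refine ENNReal.toReal_mono (ENNReal.add_lt_top.2 ⟨hv.2, hw.2⟩).ne ?_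
    rw [sobolevENorm, sobolevENorm, sobolevENorm, gagliardo, gagliardo, gagliardo, diffQuot_add]
    refine (add_le_add (eLpNorm_add_le hv.1 hw.1 h1)
      (eLpNorm_add_le (aestronglyMeasurable_diffQuot s p hv.1)
        (aestronglyMeasurable_diffQuot s p hw.1) h1)).trans (le_of_eq ?_)
    ring

instance (Ω : Set (Sp N)) (s p : ℝ) [Fact (1 < p)] : SeminormedAddCommGroup (W0 Ω s p) :=
  SeminormedAddCommGroup.ofCore (W0.core Ω s p)

instance (Ω : Set (Sp N)) (s p : ℝ) [Fact (1 < p)] : NormedSpace ℝ (W0 Ω s p) where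
  norm_smul_le c w := ((W0.core Ω s p).norm_smul c w).le

/-! ### Functions of time and space; a function `u` is written as `u t x` -/

/-- `u ∈ L^p(0,T; W^{s,p}(ℝ^N))`. -/
def MemLpW (s p T : ℝ) (u : ℝ → Sp N → ℝ) : Prop :=
  AEStronglyMeasurable (fun q : ℝ × Sp N => u q.1 q.2)
      ((volume.restrict (Ioo 0 T)).prod volume) ∧
    ∫⁻ t in Ioo 0 T, sobolevENorm s p (u t) ^ p < ⊤

/-- `u ∈ L^p(0,T; W^{s,p}_0(Ω))`. -/
def MemLpW0 (Ω : Set (Sp N)) (s p T : ℝ) (u : ℝ → Sp N → ℝ) : Prop :=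
  MemLpW s p T u ∧ ∀ᵐ t ∂(volume.restrict (Ioo 0 T)), ∀ᵐ x, x ∉ Ω → u t x = 0

/-- `u ∈ C([0,T]; L²(Ω))`. -/
def ContinuousInL2 (Ω : Set (Sp N)) (T : ℝ) (u : ℝ → Sp N → ℝ) : Prop :=
  (∀ t ∈ Icc 0 T, MemLp (u t) 2 (volume.restrict Ω)) ∧
    ∀ t₀ ∈ Icc 0 T, Tendsto (fun t => eLpNorm (u t - u t₀) 2 (volume.restrict Ω))
      (𝓝[Icc 0 T] t₀) (𝓝 0)

/-- Lebesgue measure on the cylinder `(0,T) × Ω`. -/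
def cylinder (Ω : Set (Sp N)) (T : ℝ) : Measure (ℝ × Sp N) :=
  (volume.restrict (Ioo 0 T)).prod (volume.restrict Ω)

/-- `φ ∈ C_0^∞(Ω × (0,T))`. -/
def IsTestFunction (Ω : Set (Sp N)) (T : ℝ) (φ : ℝ → Sp N → ℝ) : Prop :=
  ContDiff ℝ ∞ (fun q : ℝ × Sp N => φ q.1 q.2) ∧
    HasCompactSupport (fun q : ℝ × Sp N => φ q.1 q.2) ∧
    tsupport (fun q : ℝ × Sp N => φ q.1 q.2) ⊆ Ioo 0 T ×ˢ Ω

/-- `g` is the weak derivative `∂_t v` on `Ω × (0,T)`. -/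
def IsWeakTimeDeriv (Ω : Set (Sp N)) (T : ℝ) (v g : ℝ → Sp N → ℝ) : Prop :=
  ∀ φ : ℝ → Sp N → ℝ, IsTestFunction Ω T φ →
    ∫ q, v q.1 q.2 * deriv (fun t => φ t q.2) q.1 ∂(cylinder Ω T)
      = - ∫ q, g q.1 q.2 * φ q.1 q.2 ∂(cylinder Ω T)

/-! ### The equation -/

/-- `H` is a Caratheodory function, convex in its last variable, with
`H(x,y,ξ) ≥ A (|ξ| / |x-y|^s)^p`. -/
structure IsAdmissible (s p A : ℝ) (H : Sp N → Sp N → ℝ → ℝ) : Prop where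
  measurable : ∀ ξ : ℝ, AEMeasurable (fun z : Sp N × Sp N => H z.1 z.2 ξ) volume
  continuous : ∀ᵐ z : Sp N × Sp N, Continuous (H z.1 z.2)
  convex : ∀ᵐ z : Sp N × Sp N, ConvexOn ℝ univ (H z.1 z.2)
  lower : ∀ᵐ z : Sp N × Sp N, ∀ ξ : ℝ, A * (|ξ| / ‖z.1 - z.2‖ ^ s) ^ p ≤ H z.1 z.2 ξ

/-- `∬ H(x, y, w x - w y) / |x-y|^N dx dy`, with values in `[0, ∞]` (here `H ≥ 0`). -/
def energy (H : Sp N → Sp N → ℝ → ℝ) (w : Sp N → ℝ) : ℝ≥0∞ :=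
  ∫⁻ z : Sp N × Sp N, ENNReal.ofReal (H z.1 z.2 (w z.1 - w z.2) / ‖z.1 - z.2‖ ^ N)

/-- Time-independent Cauchy-Dirichlet data. -/
structure IsData (Ω : Set (Sp N)) (s p : ℝ) (H : Sp N → Sp N → ℝ → ℝ) (u₀ : Sp N → ℝ) :
    Prop where
  memW : MemW s p u₀
  memL2 : MemLp u₀ 2 (volume.restrict Ω)
  energy_lt_top : energy H u₀ < ⊤

/-- `v` is a comparison function on `(0,T)` with `∂_t v = g ∈ L²(Ω × (0,T))`. The function `v`
is represented so that it is continuous in time with values in `L²(Ω)`, which gives a meaning to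
`v(·,0)` and `v(·,T)`. -/
structure IsComparison (Ω : Set (Sp N)) (s p : ℝ) (u₀ : Sp N → ℝ) (T : ℝ)
    (v g : ℝ → Sp N → ℝ) : Prop where
  memLpW : MemLpW s p T v
  boundary : MemLpW0 Ω s p T (fun t => v t - u₀)
  continuousInL2 : ContinuousInL2 Ω T v
  deriv_memLp : MemLp (fun q : ℝ × Sp N => g q.1 q.2) 2 (cylinder Ω T)
  deriv_eq : IsWeakTimeDeriv Ω T v g

/-- `u` is a variational solution with Cauchy-Dirichlet data `u₀`. The inequality is one between
extended real numbers, since the energies may be infinite. -/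
structure IsVariationalSolution (Ω : Set (Sp N)) (s p : ℝ) (H : Sp N → Sp N → ℝ → ℝ)
    (u₀ : Sp N → ℝ) (u : ℝ → Sp N → ℝ) : Prop where
  memLpW : ∀ T > 0, MemLpW s p T u
  boundary : ∀ T > 0, MemLpW0 Ω s p T (fun t => u t - u₀)
  continuousInL2 : ∀ T > 0, ContinuousInL2 Ω T u
  inequality : ∀ T > 0, ∀ v g : ℝ → Sp N → ℝ, IsComparison Ω s p u₀ T v g →
    ((∫⁻ t in Ioo 0 T, energy H (u t) : ℝ≥0∞) : EReal) ≤
      ((∫⁻ t in Ioo 0 T, energy H (v t) : ℝ≥0∞) : EReal) +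
        (((∫ q, g q.1 q.2 * (v q.1 q.2 - u q.1 q.2) ∂(cylinder Ω T))
          + (1 / 2) * (∫ x in Ω, (v 0 x - u₀ x) ^ 2)
          - (1 / 2) * (∫ x in Ω, (v T x - u T x) ^ 2) : ℝ) : EReal)

/-- `F ∈ L^{p'}(0,T; (W^{s,p}_0(Ω))^*)`, with `p' = p / (p - 1)` (strong measurability and the dual
norm), and `F = ∂_t u` on `(0,T)`: for every `w` in `W^{s,p}_0(Ω) ∩ L²(Ω)`, which is dense in
`W^{s,p}_0(Ω)`, the function `t ↦ ⟨F(t), w⟩` is the distributional derivative of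
`t ↦ ∫_Ω u(x,t) w(x) dx`. -/
def IsTimeDeriv (Ω : Set (Sp N)) (s p T : ℝ) [Fact (1 < p)] (u : ℝ → Sp N → ℝ)
    (F : ℝ → StrongDual ℝ (W0 Ω s p)) : Prop :=
  MemLp F (ENNReal.ofReal (p / (p - 1))) (volume.restrict (Ioo 0 T)) ∧
    ∀ w : W0 Ω s p, MemLp (w : Sp N → ℝ) 2 (volume.restrict Ω) →
      ∀ η : ℝ → ℝ, ContDiff ℝ ∞ η → HasCompactSupport η → tsupport η ⊆ Ioo 0 T →
        ∫ t in Ioo 0 T, F t w * η t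
          = - ∫ t in Ioo 0 T, (∫ x in Ω, u t x * w x) * deriv η t

/-- `∂_ξ H(x, y, u(x,t) - u(y,t)) (φ(x,t) - φ(y,t)) / |x-y|^N`. -/
def weakIntegrand (H : Sp N → Sp N → ℝ → ℝ) (u φ : ℝ → Sp N → ℝ) (q : ℝ × (Sp N × Sp N)) : ℝ :=
  deriv (H q.2.1 q.2.2) (u q.1 q.2.1 - u q.1 q.2.2) * (φ q.1 q.2.1 - φ q.1 q.2.2)
    / ‖q.2.1 - q.2.2‖ ^ N

/-- `u` is a weak solution on `(0,T)` with Cauchy-Dirichlet data `u₀`. A test function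
`φ ∈ C_0^∞(Ω × (0,τ))` is given as a map from times to `W^{s,p}_0(Ω)`, a space which contains every
`φ(·,t)`. -/
structure IsWeakSolution (Ω : Set (Sp N)) (s p : ℝ) [Fact (1 < p)] (H : Sp N → Sp N → ℝ → ℝ)
    (u₀ : Sp N → ℝ) (T : ℝ) (u : ℝ → Sp N → ℝ) : Prop where
  memLpW : MemLpW s p T u
  boundary : MemLpW0 Ω s p T (fun t => u t - u₀)
  continuousInL2 : ContinuousInL2 Ω T u
  initial : ∀ᵐ x ∂(volume.restrict Ω), u 0 x = u₀ x
  equation : ∃ F : ℝ → StrongDual ℝ (W0 Ω s p), IsTimeDeriv Ω s p T u F ∧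
    ∀ τ ∈ Ioc 0 T, ∀ φ : ℝ → W0 Ω s p, IsTestFunction Ω τ (fun t => (φ t : Sp N → ℝ)) →
      Integrable (weakIntegrand H u (fun t => (φ t : Sp N → ℝ)))
        ((volume.restrict (Ioo 0 τ)).prod volume) ∧
      IntegrableOn (fun t => F t (φ t)) (Ioo 0 τ) ∧
      (∫ q, weakIntegrand H u (fun t => (φ t : Sp N → ℝ)) q
          ∂((volume.restrict (Ioo 0 τ)).prod volume))
        + (∫ t in Ioo 0 τ, F t (φ t)) = 0

end NonlocalEvolution

end

/-! The obstacle is that `u` has no time derivative in L², so neither `u` nor a perturbation of it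
may be inserted in the variational inequality. The cure is the exponential average v = [U]_h, the
solution of h ∂_t v = U - v with v(0) = u₀. Its time derivative (U - v)/h is in L². Moreover v(t) is
a mean of u₀ and of the past of U against a probability weight, so Jensen's inequality gives ∫ E(v)
≤ h E(u₀) + ∫ E(U) (`lintegral_energy_timeAvg_le`), and v is admissible (`isComparison_timeAvg`).

For η ∈ C_0^∞(0,T) and w ∈ W_0^{s,p}(Ω) ∩ L²(Ω) take U = u + ε(η + hη')w. Then v = [u]_h + εηw
exactly. In ∫∫ ∂_t v (v - u) the square -|u - [u]_h|²/h has the good sign, and integration by parts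
in time reduces the rest to -ε ∫∫ u η' w (`integral_deriv_timeAvg_mul_sub_le`,
`perturbed_inequality`). With h = ε² the error h E(u₀) is negligible against ε. Dividing by ε, using
convexity and letting ε → 0 yields one half of the Euler-Lagrange identity; replacing η by -η yields
the other (`integral_mul_deriv_eq`).

The identity says that ∂_t u is minus the flux functional. A convex function between 0 and c|ξ|^p
has derivative at most a multiple of |ξ|^(p-1), so the flux is a curve in L^{p'}, strongly
measurable because that space is separable; a continuous linear map carries it to the dual of
W_0^{s,p}(Ω). Since F is given by this formula at almost every time, simultaneously for all w, the
weak equation for a general φ is Fubini's theorem, and no approximation of φ by products is needed.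

The initial value comes from the constant comparison function u₀, which gives ‖u(t) - u₀‖² ≤ 2t
E(u₀) in L²(Ω). -/

open MeasureTheory Set Filter Topology
open scoped ENNReal ContDiff

noncomputable section

namespace NonlocalEvolution

/-! ### Exponential averages of functions of one variable -/

/-- The exponential average of `f` with initial value `a` at scale `h`: the solution `y` of
`h y' = f - y`, `y 0 = a`. -/
def expAvg (h a : ℝ) (f : ℝ → ℝ) (t : ℝ) : ℝ :=
  Real.exp (-(t / h)) * (a + h⁻¹ * ∫ s in (0 : ℝ)..t, Real.exp (s / h) * f s)

@[simp] lemma expAvg_zero (h a : ℝ) (f : ℝ → ℝ) : expAvg h a f 0 = a := by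
  simp [expAvg]

lemma continuous_exp_div (h : ℝ) : Continuous fun s : ℝ => Real.exp (s / h) := by
  fun_prop

lemma intervalIntegrable_exp_mul {h T t : ℝ} (ht : t ∈ Icc 0 T) {f : ℝ → ℝ}
    (hf : IntegrableOn f (Ioo 0 T)) :
    IntervalIntegrable (fun s => Real.exp (s / h) * f s) volume 0 t := by
  have h1 : IntervalIntegrable f volume 0 T := by
    rw [intervalIntegrable_iff_integrableOn_Ioo_of_le (ht.1.trans ht.2)]
    exact hf
  have h2 : IntervalIntegrable f volume 0 t :=
    h1.mono_set (by
      rw [uIcc_of_le ht.1, uIcc_of_le (ht.1.trans ht.2)]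
      exact Icc_subset_Icc_right ht.2)
  exact h2.continuousOn_mul (continuous_exp_div h).continuousOn

lemma expAvg_congr {h a T : ℝ} {f g : ℝ → ℝ}
    (hfg : f =ᵐ[volume.restrict (Ioo 0 T)] g) {t : ℝ} (ht : t ∈ Icc 0 T) :
    expAvg h a f t = expAvg h a g t := by
  have : ∫ s in (0 : ℝ)..t, Real.exp (s / h) * f s = ∫ s in (0 : ℝ)..t, Real.exp (s / h) * g s := by
    rw [intervalIntegral.integral_of_le ht.1, intervalIntegral.integral_of_le ht.1]
    refine integral_congr_ae ?_
    have h1 := ae_restrict_of_ae_restrict_of_subset (Ioo_subset_Ioo_right ht.2) hfg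
    rw [Measure.restrict_congr_set Ioo_ae_eq_Ioc] at h1
    filter_upwards [h1] with s hs
    rw [hs]
  rw [expAvg, expAvg, this]

lemma expAvg_add {h T : ℝ} {f g : ℝ → ℝ} (hf : IntegrableOn f (Ioo 0 T))
    (hg : IntegrableOn g (Ioo 0 T)) (a b : ℝ) {t : ℝ} (ht : t ∈ Icc 0 T) :
    expAvg h (a + b) (fun s => f s + g s) t = expAvg h a f t + expAvg h b g t := by
  simp only [expAvg, mul_add]
  rw [intervalIntegral.integral_add (intervalIntegrable_exp_mul ht hf)
    (intervalIntegrable_exp_mul ht hg)]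
  ring

lemma expAvg_const_mul (h a c : ℝ) (f : ℝ → ℝ) (t : ℝ) :
    expAvg h (c * a) (fun s => c * f s) t = c * expAvg h a f t := by
  simp only [expAvg, mul_left_comm _ c, intervalIntegral.integral_const_mul]
  ring

lemma expAvg_sub {h T : ℝ} {f g : ℝ → ℝ} (hf : IntegrableOn f (Ioo 0 T))
    (hg : IntegrableOn g (Ioo 0 T)) (a b : ℝ) {t : ℝ} (ht : t ∈ Icc 0 T) :
    expAvg h (a - b) (fun s => f s - g s) t = expAvg h a f t - expAvg h b g t := by
  have h1 := expAvg_const_mul h b (-1) g t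
  have h2 := expAvg_add (h := h) hf (hg.const_mul (-1)) a (-1 * b) ht
  simp only [neg_one_mul, ← sub_eq_add_neg] at h1 h2
  rw [h2, h1, sub_eq_add_neg]

lemma hasDerivAt_exp_neg_div (h t : ℝ) :
    HasDerivAt (fun t : ℝ => Real.exp (-(t / h))) (-(h⁻¹) * Real.exp (-(t / h))) t := by
  have h1 : HasDerivAt (fun t : ℝ => -(t / h)) (-(1 / h)) t := ((hasDerivAt_id t).div_const h).neg
  convert h1.exp using 1
  ring

lemma absolutelyContinuousOnInterval_of_contDiff {f : ℝ → ℝ} (hf : ContDiff ℝ 1 f) (a b : ℝ) :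
    AbsolutelyContinuousOnInterval f a b := by
  obtain ⟨K, hK⟩ := (hf.contDiffOn (s := uIcc a b)).exists_lipschitzOnWith one_ne_zero
    (convex_uIcc a b) isCompact_uIcc
  exact hK.absolutelyContinuousOnInterval

lemma absolutelyContinuousOnInterval_const (c a b : ℝ) :
    AbsolutelyContinuousOnInterval (fun _ : ℝ => c) a b :=
  absolutelyContinuousOnInterval_of_contDiff contDiff_const a b

lemma absolutelyContinuousOnInterval_expAvg {h a T : ℝ} (hT : 0 ≤ T) {f : ℝ → ℝ}
    (hf : IntegrableOn f (Ioo 0 T)) :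
    AbsolutelyContinuousOnInterval (expAvg h a f) 0 T := by
  have h1 := (intervalIntegrable_exp_mul (h := h) (right_mem_Icc.2 hT)
    hf).absolutelyContinuousOnInterval_intervalIntegral (c := 0) (by simp)
  have h2 : AbsolutelyContinuousOnInterval (fun t : ℝ => Real.exp (-(t / h))) 0 T :=
    absolutelyContinuousOnInterval_of_contDiff (by fun_prop) 0 T
  exact h2.mul ((absolutelyContinuousOnInterval_const a 0 T).add (h1.const_mul h⁻¹))

lemma ae_hasDerivAt_expAvg {h a T : ℝ} (hT : 0 ≤ T) {f : ℝ → ℝ}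
    (hf : IntegrableOn f (Ioo 0 T)) :
    ∀ᵐ t, t ∈ Icc 0 T → HasDerivAt (expAvg h a f) ((f t - expAvg h a f t) / h) t := by
  have h1 := (intervalIntegrable_exp_mul (h := h) (right_mem_Icc.2 hT) hf).ae_hasDerivAt_integral
  filter_upwards [h1] with t ht1 ht
  have h2 := ht1 (by rwa [uIcc_of_le hT]) 0 (by simp)
  have h3 : HasDerivAt (expAvg h a f) _ t :=
    (hasDerivAt_exp_neg_div h t).mul ((h2.const_mul h⁻¹).const_add a)
  refine h3.congr_deriv ?_
  have h4 : Real.exp (-(t / h)) * Real.exp (t / h) = 1 := by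
    rw [← Real.exp_add]
    simp
  have h5 : expAvg h a f t
      = Real.exp (-(t / h)) * (a + h⁻¹ * ∫ s in (0 : ℝ)..t, Real.exp (s / h) * f s) := rfl
  rw [h5]
  linear_combination (f t * h⁻¹) * h4

lemma expAvg_sub_eq_integral {h a T : ℝ} {f : ℝ → ℝ}
    (hf : IntegrableOn f (Ioo 0 T)) {r t : ℝ} (hr : r ∈ Icc 0 T) (ht : t ∈ Icc 0 T) :
    expAvg h a f t - expAvg h a f r = ∫ s in r..t, (f s - expAvg h a f s) / h := by
  have hT := hr.1.trans hr.2
  have hsub : uIcc r t ⊆ uIcc 0 T := by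
    rw [uIcc_of_le hT]
    exact uIcc_subset_Icc hr ht
  rw [← ((absolutelyContinuousOnInterval_expAvg (h := h) (a := a) hT hf).mono
    hsub).integral_deriv_eq_sub]
  refine intervalIntegral.integral_congr_ae ?_
  filter_upwards [ae_hasDerivAt_expAvg (h := h) (a := a) hT hf] with s hs hs1
  rw [uIcc_of_le hT] at hsub
  exact (hs (hsub (uIoc_subset_uIcc hs1))).deriv

lemma integral_expAvg_mul_deriv {h a T : ℝ} (hT : 0 ≤ T) {f : ℝ → ℝ}
    (hf : IntegrableOn f (Ioo 0 T)) {ψ : ℝ → ℝ} (hψ : ContDiff ℝ 1 ψ) (h0 : ψ 0 = 0)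
    (h1 : ψ T = 0) :
    ∫ t in Ioo 0 T, expAvg h a f t * deriv ψ t
      = - ∫ t in Ioo 0 T, (f t - expAvg h a f t) / h * ψ t := by
  have h2 := (absolutelyContinuousOnInterval_expAvg (h := h) (a := a) hT
    hf).integral_mul_deriv_eq_deriv_mul (absolutelyContinuousOnInterval_of_contDiff hψ 0 T)
  rw [← integral_Ioc_eq_integral_Ioo, ← integral_Ioc_eq_integral_Ioo,
    ← intervalIntegral.integral_of_le hT, ← intervalIntegral.integral_of_le hT, h2, h0, h1]
  simp only [mul_zero, sub_zero, zero_sub]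
  congr 1
  refine intervalIntegral.integral_congr_ae ?_
  filter_upwards [ae_hasDerivAt_expAvg (h := h) (a := a) hT hf] with s hs hs1
  rw [uIoc_of_le hT] at hs1
  rw [(hs (Ioc_subset_Icc_self hs1)).deriv]

/-- A primitive of e^(s/h)(η + hη') is h e^(s/h) η. The perturbation can thus be prepared beforehand
so that averaging returns η itself, with no smoothing error. -/
lemma expAvg_add_mul_deriv {h : ℝ} (hh : h ≠ 0) {η : ℝ → ℝ} (hη : ContDiff ℝ 1 η) (h0 : η 0 = 0)
    (t : ℝ) : expAvg h 0 (fun s => η s + h * deriv η s) t = η t := by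
  have h1 : ∀ s, HasDerivAt (fun s => h * (Real.exp (s / h) * η s))
      (Real.exp (s / h) * (η s + h * deriv η s)) s := by
    intro s
    have h2 : HasDerivAt (fun t : ℝ => t / h) (1 / h) s := (hasDerivAt_id s).div_const h
    have h3 := (h2.exp.mul (hη.differentiable one_ne_zero s).hasDerivAt).const_mul h
    refine h3.congr_deriv ?_
    linear_combination Real.exp (s / h) * η s * mul_inv_cancel₀ hh
  have h5 : Continuous (deriv η) := hη.continuous_deriv le_rfl
  have h4 := intervalIntegral.integral_eq_sub_of_hasDerivAt (a := 0) (b := t) (fun s _ => h1 s)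
    (Continuous.intervalIntegrable (by have := hη.continuous; fun_prop) _ _)
  rw [expAvg, h4, h0]
  have h6 : Real.exp (-(t / h)) * Real.exp (t / h) = 1 := by
    rw [← Real.exp_add]
    simp
  linear_combination (η t) * h6
    + η t * Real.exp (-(t / h)) * Real.exp (t / h) * inv_mul_cancel₀ hh

lemma integral_exp_div {h : ℝ} (hh : h ≠ 0) (t : ℝ) :
    h⁻¹ * ∫ s in (0 : ℝ)..t, Real.exp (s / h) = Real.exp (t / h) - 1 := by
  rw [intervalIntegral.integral_comp_div (fun x => Real.exp x) hh, integral_exp]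
  simp [hh]

lemma expAvg_const {h : ℝ} (hh : h ≠ 0) (c t : ℝ) : expAvg h c (fun _ => c) t = c := by
  have h6 : Real.exp (-(t / h)) * Real.exp (t / h) = 1 := by
    rw [← Real.exp_add]
    simp
  have h1 := integral_exp_div hh t
  rw [expAvg, intervalIntegral.integral_mul_const]
  linear_combination c * h6 + c * Real.exp (-(t / h)) * h1

lemma expAvg_mono {h T : ℝ} (hh : 0 < h) {f g : ℝ → ℝ} (hf : IntegrableOn f (Ioo 0 T))
    (hg : IntegrableOn g (Ioo 0 T)) {a b : ℝ} (hab : a ≤ b) (hfg : ∀ s, f s ≤ g s) {t : ℝ}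
    (ht : t ∈ Icc 0 T) : expAvg h a f t ≤ expAvg h b g t := by
  rw [expAvg, expAvg]
  have := intervalIntegral.integral_mono_on ht.1 (intervalIntegrable_exp_mul (h := h) ht hf)
    (intervalIntegrable_exp_mul (h := h) ht hg)
    (fun s _ => mul_le_mul_of_nonneg_left (hfg s) (Real.exp_pos _).le)
  gcongr

/-- Jensen's inequality. The average integrates against e^(-t/h) at the initial value plus h⁻¹
e^(-(t-s)/h) ds on [0,t], a measure of total mass 1. Only a supporting line of Φ at the average is
used. -/
lemma comp_expAvg_le {h T : ℝ} (hh : 0 < h) {f Φ : ℝ → ℝ} (a : ℝ)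
    (hf : IntegrableOn f (Ioo 0 T)) (hΦf : IntegrableOn (fun s => Φ (f s)) (Ioo 0 T))
    (hΦ : ∀ c, ∃ m, ∀ y, Φ c + m * (y - c) ≤ Φ y) {t : ℝ} (ht : t ∈ Icc 0 T) :
    Φ (expAvg h a f t) ≤ expAvg h (Φ a) (fun s => Φ (f s)) t := by
  set c := expAvg h a f t with hc
  obtain ⟨m, hm⟩ := hΦ c
  have hint : ∀ k : ℝ, IntegrableOn (fun _ : ℝ => k) (Ioo 0 T) := fun k => by simp
  -- An affine function commutes with the average, so the supporting line at `c` averages to Φ c.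
  have h1 : expAvg h (Φ c + m * (a - c)) (fun s => Φ c + m * (f s - c)) t = Φ c := by
    rw [expAvg_add (g := fun s => m * (f s - c)) (hint _) ((hf.sub (hint c)).const_mul m) _ _ ht,
      expAvg_const hh.ne',
      expAvg_const_mul, expAvg_sub hf (hint c) _ _ ht, expAvg_const hh.ne', ← hc]
    simp
  rw [← h1]
  exact expAvg_mono hh ((hint _).add ((hf.sub (hint c)).const_mul m)) hΦf (hm a)
    (fun s => hm _) ht

/-- Let y be the average of Φ(f). Integrating h y' = Φ(f) - y over (0,T) and discarding h y(T) ≥ 0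
gives the bound. The constant in front of the last integral is exactly 1 and the error is of order
h; both matter when the inequality is later divided by ε. -/
lemma lintegral_comp_expAvg_le {h T : ℝ} (hh : 0 < h) (hT : 0 < T) {f Φ : ℝ → ℝ} (a : ℝ)
    (hf : IntegrableOn f (Ioo 0 T))
    (hΦf : AEStronglyMeasurable (fun s => Φ (f s)) (volume.restrict (Ioo 0 T)))
    (hΦ0 : ∀ y, 0 ≤ Φ y) (hΦ : ∀ c, ∃ m, ∀ y, Φ c + m * (y - c) ≤ Φ y) :
    ∫⁻ t in Ioo 0 T, ENNReal.ofReal (Φ (expAvg h a f t))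
      ≤ ENNReal.ofReal h * ENNReal.ofReal (Φ a) + ∫⁻ t in Ioo 0 T, ENNReal.ofReal (Φ (f t)) := by
  by_cases htop : ∫⁻ t in Ioo 0 T, ENNReal.ofReal (Φ (f t)) = ⊤
  · simp [htop]
  have hint : IntegrableOn (fun s => Φ (f s)) (Ioo 0 T) :=
    (lintegral_ofReal_ne_top_iff_integrable hΦf (ae_of_all _ fun s => hΦ0 _)).1 htop
  set y := expAvg h (Φ a) (fun s => Φ (f s)) with hy
  have hle : ∀ t ∈ Icc 0 T, Φ (expAvg h a f t) ≤ y t :=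
    fun t ht => comp_expAvg_le hh a hf hint hΦ ht
  have hyint : IntegrableOn y (Ioo 0 T) := by
    have := (absolutelyContinuousOnInterval_expAvg (h := h) (a := Φ a) hT.le hint).continuousOn
    rw [uIcc_of_le hT.le] at this
    exact (this.integrableOn_compact isCompact_Icc).mono_set Ioo_subset_Icc_self
  have h1 := expAvg_sub_eq_integral (h := h) (a := Φ a) hint (left_mem_Icc.2 hT.le)
    (right_mem_Icc.2 hT.le)
  rw [intervalIntegral.integral_of_le hT.le, integral_Ioc_eq_integral_Ioo, integral_div,
    integral_sub hint hyint, expAvg_zero, eq_div_iff hh.ne'] at h1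
  have hyT : 0 ≤ y T := (hΦ0 _).trans (hle T (right_mem_Icc.2 hT.le))
  calc ∫⁻ t in Ioo 0 T, ENNReal.ofReal (Φ (expAvg h a f t))
      ≤ ∫⁻ t in Ioo 0 T, ENNReal.ofReal (y t) :=
        setLIntegral_mono_ae' measurableSet_Ioo (ae_of_all _ fun t ht =>
          ENNReal.ofReal_le_ofReal (hle t (Ioo_subset_Icc_self ht)))
    _ = ENNReal.ofReal (∫ t in Ioo 0 T, y t) := by
        rw [ofReal_integral_eq_lintegral_ofReal hyint]
        refine (ae_restrict_iff' measurableSet_Ioo).2 (ae_of_all _ fun t ht => ?_)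
        exact (hΦ0 _).trans (hle t (Ioo_subset_Icc_self ht))
    _ ≤ ENNReal.ofReal (h * Φ a + ∫ t in Ioo 0 T, Φ (f t)) := by
        refine ENNReal.ofReal_le_ofReal ?_
        nlinarith [mul_nonneg hyT hh.le]
    _ = _ := by
        rw [ENNReal.ofReal_add (mul_nonneg hh.le (hΦ0 a))
          (integral_nonneg fun t => hΦ0 _), ENNReal.ofReal_mul hh.le,
          ofReal_integral_eq_lintegral_ofReal hint (ae_of_all _ fun s => hΦ0 _)]

/-! ### Measurability and integrability on a product with a time interval -/

section SpaceTime

variable {X : Type*} [MeasurableSpace X] {μ : Measure X}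

lemma ae_ae_of_ae_prod_swap {Y : Type*} [MeasurableSpace Y] {ν : Measure Y} [SFinite μ] [SFinite ν]
    {P : Y × X → Prop} (h : ∀ᵐ q ∂(ν.prod μ), P q) : ∀ᵐ x ∂μ, ∀ᵐ t ∂ν, P (t, x) := by
  have h1 : ∀ᵐ q ∂(μ.prod ν), P q.swap :=
    Measure.measurePreserving_swap.quasiMeasurePreserving.ae h
  exact Measure.ae_ae_of_ae_prod h1

lemma ae_prod_of_ae_snd {Y : Type*} [MeasurableSpace Y] {ν : Measure Y} [SFinite μ] [SFinite ν]
    {P : X → Prop} (h : ∀ᵐ x ∂μ, P x) : ∀ᵐ q ∂(ν.prod μ), P q.2 :=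
  Measure.quasiMeasurePreserving_snd.ae h

/-- Averages are taken for each x separately, and the linearity and differentiation rules need a
genuinely integrable time slice. Tonelli's theorem and the finite length of (0,T) provide it for
almost every x. -/
lemma ae_integrableOn_section {T : ℝ} [SFinite μ] {r : ℝ≥0∞} (hr : 1 ≤ r) (hr' : r ≠ ⊤)
    {f : ℝ → X → ℝ}
    (hf : MemLp (fun q : ℝ × X => f q.1 q.2) r ((volume.restrict (Ioo 0 T)).prod μ)) :
    ∀ᵐ x ∂μ, IntegrableOn (fun t => f t x) (Ioo 0 T) := by
  have hr0 : r ≠ 0 := (zero_lt_one.trans_le hr).ne'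
  have h1 := hf.2
  rw [eLpNorm_lt_top_iff_lintegral_rpow_enorm_lt_top hr0 hr', lintegral_prod_symm] at h1
  · have h2 := ae_lt_top' ?_ h1.ne
    · have h3 := ae_ae_of_ae_prod_swap hf.1.ae_eq_mk
      filter_upwards [h2, h3] with x hx hx3
      have h4 : AEStronglyMeasurable (fun t => f t x) (volume.restrict (Ioo 0 T)) :=
        ⟨fun t => hf.1.mk _ (t, x),
          hf.1.stronglyMeasurable_mk.comp_measurable measurable_prodMk_right, hx3⟩
      exact MemLp.integrable hr ⟨h4,
        (eLpNorm_lt_top_iff_lintegral_rpow_enorm_lt_top hr0 hr').2 hx⟩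
    · exact (hf.1.enorm.pow_const _).prod_swap.lintegral_prod_right'
  · exact hf.1.enorm.pow_const _

lemma aestronglyMeasurable_expAvg {T h : ℝ} [SFinite μ] {f₀ : X → ℝ} {f : ℝ → X → ℝ}
    (hf₀ : AEStronglyMeasurable f₀ μ)
    (hf : AEStronglyMeasurable (fun q : ℝ × X => f q.1 q.2)
      ((volume.restrict (Ioo 0 T)).prod μ)) :
    AEStronglyMeasurable (fun q : ℝ × X => expAvg h (f₀ q.2) (fun s => f s q.2) q.1)
      ((volume.restrict (Ioo 0 T)).prod μ) := by
  have hI : ∀ᵐ q : ℝ × X ∂((volume.restrict (Ioo 0 T)).prod μ), q.1 ∈ Ioo 0 T :=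
    Measure.quasiMeasurePreserving_fst.ae (ae_restrict_mem measurableSet_Ioo)
  set F := hf.mk with hF
  have hFm : StronglyMeasurable F := hf.stronglyMeasurable_mk
  -- The moving endpoint is put into an indicator, which leaves a parameter integral over a fixed
  -- domain.
  have h1 : StronglyMeasurable (fun q : ℝ × X =>
      ∫ s, (Ioc 0 q.1).indicator (fun s => Real.exp (s / h) * F (s, q.2)) s) := by
    have h2 : StronglyMeasurable (fun z : (ℝ × X) × ℝ =>
        (Ioc 0 z.1.1).indicator (fun s => Real.exp (s / h) * F (s, z.1.2)) z.2) := by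
      have h3 : StronglyMeasurable (fun z : (ℝ × X) × ℝ =>
          Real.exp (z.2 / h) * F (z.2, z.1.2)) := by
        refine StronglyMeasurable.mul (by fun_prop : Measurable _).stronglyMeasurable ?_
        exact hFm.comp_measurable (by fun_prop)
      have h4 : MeasurableSet {z : (ℝ × X) × ℝ | z.2 ∈ Ioc 0 z.1.1} := by
        have : {z : (ℝ × X) × ℝ | z.2 ∈ Ioc 0 z.1.1}
            = {z | 0 < z.2} ∩ {z | z.2 ≤ z.1.1} := rfl
        rw [this]
        exact (measurableSet_lt measurable_const measurable_snd).inter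
          (measurableSet_le measurable_snd (measurable_fst.comp measurable_fst))
      exact h3.indicator h4
    exact h2.integral_prod_right
  have h5 : AEStronglyMeasurable (fun q : ℝ × X => Real.exp (-(q.1 / h)) * (f₀ q.2 + h⁻¹ *
      ∫ s, (Ioc 0 q.1).indicator (fun s => Real.exp (s / h) * F (s, q.2)) s))
      ((volume.restrict (Ioo 0 T)).prod μ) :=
    (by fun_prop : Measurable fun q : ℝ × X => Real.exp (-(q.1 / h))).aestronglyMeasurable.mul
      (hf₀.comp_snd.add (h1.aestronglyMeasurable.const_mul _))
  refine h5.congr ?_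
  have h6 := ae_prod_of_ae_snd (ν := volume.restrict (Ioo 0 T)) (ae_ae_of_ae_prod_swap hf.ae_eq_mk)
  filter_upwards [h6, hI] with q hq hq1
  rw [expAvg_congr (g := fun s => F (s, q.2)) hq (Ioo_subset_Icc_self hq1), expAvg,
    intervalIntegral.integral_of_le hq1.1.le, integral_indicator measurableSet_Ioc]

lemma lintegral_comp_expAvg_prod_le {T h : ℝ} [SFinite μ] (hh : 0 < h) (hT : 0 < T) {f₀ : X → ℝ}
    {f : ℝ → X → ℝ} {Φ : X → ℝ → ℝ} (hf₀ : AEStronglyMeasurable f₀ μ)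
    (hf : AEStronglyMeasurable (fun q : ℝ × X => f q.1 q.2) ((volume.restrict (Ioo 0 T)).prod μ))
    (hfi : ∀ᵐ x ∂μ, IntegrableOn (fun t => f t x) (Ioo 0 T))
    (hΦm : Measurable (Function.uncurry Φ)) (hΦ0 : ∀ x y, 0 ≤ Φ x y)
    (hΦ : ∀ x c, ∃ m, ∀ y, Φ x c + m * (y - c) ≤ Φ x y) :
    ∫⁻ q, ENNReal.ofReal (Φ q.2 (expAvg h (f₀ q.2) (fun s => f s q.2) q.1))
        ∂((volume.restrict (Ioo 0 T)).prod μ)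
      ≤ ENNReal.ofReal h * ∫⁻ x, ENNReal.ofReal (Φ x (f₀ x)) ∂μ
        + ∫⁻ q, ENNReal.ofReal (Φ q.2 (f q.1 q.2)) ∂((volume.restrict (Ioo 0 T)).prod μ) := by
  have hc : ∀ {g : ℝ × X → ℝ}, AEStronglyMeasurable g ((volume.restrict (Ioo 0 T)).prod μ) →
      AEMeasurable (fun q : ℝ × X => ENNReal.ofReal (Φ q.2 (g q)))
        ((volume.restrict (Ioo 0 T)).prod μ) := fun hg =>
    (hΦm.comp_aemeasurable (measurable_snd.aemeasurable.prodMk hg.aemeasurable)).ennreal_ofReal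
  rw [lintegral_prod_symm _ (hc (aestronglyMeasurable_expAvg hf₀ hf)),
    lintegral_prod_symm _ (hc hf)]
  have hm0 : AEMeasurable (fun x => ENNReal.ofReal (Φ x (f₀ x))) μ :=
    (hΦm.comp_aemeasurable (aemeasurable_id.prodMk hf₀.aemeasurable)).ennreal_ofReal
  rw [← lintegral_const_mul'' _ hm0, ← lintegral_add_left' (hm0.const_mul _)]
  refine lintegral_mono_ae ?_
  filter_upwards [hfi] with x hx
  refine lintegral_comp_expAvg_le hh hT (f₀ x) hx ?_ (hΦ0 x) (hΦ x)
  exact ((hΦm.comp measurable_prodMk_left).comp_aemeasurable hx.1.aemeasurable).aestronglyMeasurable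

lemma exists_forall_add_mul_sub_le {φ : ℝ → ℝ} (hφ : ConvexOn ℝ univ φ) (c : ℝ) :
    ∃ m, ∀ y, φ c + m * (y - c) ≤ φ y := by
  refine ⟨derivWithin φ (Ioi c) c, fun y => ?_⟩
  have hi : c ∈ interior (univ : Set ℝ) := by simp
  rcases lt_trichotomy y c with h | rfl | h
  · have h1 := (hφ.slope_le_leftDeriv_of_mem_interior (mem_univ y) hi h).trans
      (hφ.leftDeriv_le_rightDeriv_of_mem_interior hi)
    rw [slope_def_field, div_le_iff₀ (sub_pos.2 h)] at h1
    linarith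
  · simp
  · have h1 := hφ.rightDeriv_le_slope_of_mem_interior hi (mem_univ y) h
    rw [slope_def_field, le_div_iff₀ (sub_pos.2 h)] at h1
    linarith

lemma convexOn_abs_rpow {p : ℝ} (hp : 1 ≤ p) : ConvexOn ℝ univ fun y : ℝ => |y| ^ p := by
  have h1 : ConvexOn ℝ univ fun y : ℝ => |y| := convexOn_norm convex_univ
  refine ⟨convex_univ, fun x _ y _ a b ha hb hab => ?_⟩
  have h2 := h1.2 (mem_univ x) (mem_univ y) ha hb hab
  have h3 := (convexOn_rpow hp).2 (abs_nonneg x) (abs_nonneg y) ha hb hab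
  exact (Real.rpow_le_rpow (abs_nonneg _) h2 (by linarith)).trans h3

lemma memLp_ofReal_iff {Y : Type*} [MeasurableSpace Y] {ν : Measure Y} {p : ℝ} (hp : 0 < p)
    {g : Y → ℝ} (hg : AEStronglyMeasurable g ν) :
    MemLp g (ENNReal.ofReal p) ν ↔ ∫⁻ y, ENNReal.ofReal (|g y| ^ p) ∂ν < ⊤ := by
  have h0 : ENNReal.ofReal p ≠ 0 := by simpa using hp
  have h1 : ∀ y, ‖g y‖ₑ ^ p = ENNReal.ofReal (|g y| ^ p) := fun y => by
    rw [Real.enorm_eq_ofReal_abs, ENNReal.ofReal_rpow_of_nonneg (abs_nonneg _) hp.le]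
  rw [MemLp, and_iff_right hg,
    eLpNorm_lt_top_iff_lintegral_rpow_enorm_lt_top h0 ENNReal.ofReal_ne_top,
    ENNReal.toReal_ofReal hp.le]
  simp only [h1]

lemma memLp_expAvg {T h p : ℝ} [SFinite μ] (hh : 0 < h) (hT : 0 < T) (hp : 1 ≤ p) {f₀ : X → ℝ}
    {f : ℝ → X → ℝ} (hf₀ : MemLp f₀ (ENNReal.ofReal p) μ)
    (hf : MemLp (fun q : ℝ × X => f q.1 q.2) (ENNReal.ofReal p)
      ((volume.restrict (Ioo 0 T)).prod μ)) :
    MemLp (fun q : ℝ × X => expAvg h (f₀ q.2) (fun s => f s q.2) q.1) (ENNReal.ofReal p)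
      ((volume.restrict (Ioo 0 T)).prod μ) := by
  have hp0 : 0 < p := by linarith
  rw [memLp_ofReal_iff hp0 (aestronglyMeasurable_expAvg hf₀.1 hf.1)]
  refine (lintegral_comp_expAvg_prod_le (Φ := fun _ y => |y| ^ p) hh hT hf₀.1 hf.1
    (ae_integrableOn_section (by simpa using hp) ENNReal.ofReal_ne_top hf) ?_
    (fun _ y => by positivity)
    (fun _ => exists_forall_add_mul_sub_le (convexOn_abs_rpow hp))).trans_lt ?_
  · exact (by fun_prop : Measurable fun z : X × ℝ => |z.2| ^ p)
  · exact ENNReal.add_lt_top.2 ⟨ENNReal.mul_lt_top ENNReal.ofReal_lt_top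
      ((memLp_ofReal_iff hp0 hf₀.1).1 hf₀), (memLp_ofReal_iff hp0 hf.1).1 hf⟩

/-- Integration by parts on almost every time line, then Fubini. No regularity of ψ in x is required
beyond the integrability of the two products, so both smooth test functions and products η(t)w(x)
qualify. -/
lemma integral_expAvg_mul_deriv_prod {T h : ℝ} [SFinite μ] (hT : 0 < T) {f₀ : X → ℝ}
    {f ψ : ℝ → X → ℝ} (hfi : ∀ᵐ x ∂μ, IntegrableOn (fun t => f t x) (Ioo 0 T))
    (hψ : ∀ x, ContDiff ℝ 1 fun t => ψ t x) (h0 : ∀ x, ψ 0 x = 0) (h1 : ∀ x, ψ T x = 0)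
    (hi1 : Integrable (fun q : ℝ × X =>
      expAvg h (f₀ q.2) (fun s => f s q.2) q.1 * deriv (fun t => ψ t q.2) q.1)
      ((volume.restrict (Ioo 0 T)).prod μ))
    (hi2 : Integrable (fun q : ℝ × X =>
      (f q.1 q.2 - expAvg h (f₀ q.2) (fun s => f s q.2) q.1) / h * ψ q.1 q.2)
      ((volume.restrict (Ioo 0 T)).prod μ)) :
    ∫ q, expAvg h (f₀ q.2) (fun s => f s q.2) q.1 * deriv (fun t => ψ t q.2) q.1
        ∂((volume.restrict (Ioo 0 T)).prod μ)
      = - ∫ q, (f q.1 q.2 - expAvg h (f₀ q.2) (fun s => f s q.2) q.1) / h * ψ q.1 q.2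
        ∂((volume.restrict (Ioo 0 T)).prod μ) := by
  rw [integral_prod_symm _ hi1, integral_prod_symm _ hi2, ← integral_neg]
  refine integral_congr_ae ?_
  filter_upwards [hfi] with x hx
  exact integral_expAvg_mul_deriv hT.le hx (hψ x) (h0 x) (h1 x)

/-- Cauchy-Schwarz in time: a derivative in L² makes the curve 1/2-Hölder with values in L². -/
lemma eLpNorm_sub_le_of_eq_integral {T : ℝ} [SFinite μ] {v g : ℝ → X → ℝ} {r t : ℝ}
    (hr : r ∈ Icc 0 T) (ht : t ∈ Icc 0 T)
    (hg : AEStronglyMeasurable (fun q : ℝ × X => g q.1 q.2) ((volume.restrict (Ioo 0 T)).prod μ))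
    (hv : ∀ᵐ x ∂μ, v t x - v r x = ∫ s in r..t, g s x) :
    eLpNorm (v t - v r) 2 μ ≤ ENNReal.ofReal |t - r| ^ (1 / 2 : ℝ) *
      eLpNorm (fun q : ℝ × X => g q.1 q.2) 2 ((volume.restrict (Ioo 0 T)).prod μ) := by
  have h2 : (2 : ℝ≥0∞) ≠ 0 := by simp
  have h2' : (2 : ℝ≥0∞) ≠ ⊤ := by simp
  rw [eLpNorm_eq_lintegral_rpow_enorm_toReal h2 h2', eLpNorm_eq_lintegral_rpow_enorm_toReal h2 h2']
  simp only [ENNReal.toReal_ofNat]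
  rw [← ENNReal.mul_rpow_of_nonneg _ _ (by norm_num)]
  refine ENNReal.rpow_le_rpow ?_ (by norm_num)
  rw [lintegral_prod_symm _ (hg.enorm.pow_const _)]
  have hmeas : AEMeasurable (fun x => ∫⁻ s in Ioo 0 T, ‖g s x‖ₑ ^ (2 : ℝ)) μ :=
    (hg.enorm.pow_const _).prod_swap.lintegral_prod_right'
  rw [← lintegral_const_mul'' _ hmeas]
  refine lintegral_mono_ae ?_
  filter_upwards [hv, ae_ae_of_ae_prod_swap hg.ae_eq_mk] with x hx hxm
  have hgx : AEStronglyMeasurable (fun t => g t x) (volume.restrict (Ioo 0 T)) :=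
    ⟨fun t => hg.mk _ (t, x),
      hg.stronglyMeasurable_mk.comp_measurable measurable_prodMk_right, hxm⟩
  have hsub : uIoc r t ⊆ Ioc 0 T := by
    rw [uIoc]
    exact Ioc_subset_Ioc (le_min hr.1 ht.1) (max_le hr.2 ht.2)
  rw [Measure.restrict_congr_set Ioo_ae_eq_Ioc] at hgx
  have hgx' := hgx.mono_measure (Measure.restrict_mono_set volume hsub)
  rw [Pi.sub_apply, hx]
  have h3 : ‖∫ s in r..t, g s x‖ₑ ≤ ∫⁻ s in uIoc r t, ‖g s x‖ₑ := by
    rw [← ofReal_norm, intervalIntegral.norm_intervalIntegral_eq, ofReal_norm]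
    exact enorm_integral_le_lintegral_enorm _
  have h4 := eLpNorm_le_eLpNorm_mul_rpow_measure_univ (p := 1) (q := 2) (by norm_num) hgx'
  rw [eLpNorm_one_eq_lintegral_enorm, eLpNorm_eq_lintegral_rpow_enorm_toReal h2 h2'] at h4
  simp only [Measure.restrict_apply_univ, ENNReal.toReal_ofNat, ENNReal.toReal_one] at h4
  have h5 : volume (uIoc r t) = ENNReal.ofReal |t - r| := by
    rw [uIoc, Real.volume_Ioc, max_sub_min_eq_abs, abs_sub_comm]
  rw [h5] at h4
  calc ‖∫ s in r..t, g s x‖ₑ ^ (2 : ℝ)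
      ≤ ((∫⁻ s in uIoc r t, ‖g s x‖ₑ ^ (2 : ℝ)) ^ (1 / 2 : ℝ)
          * ENNReal.ofReal |t - r| ^ (1 / 1 - 1 / 2 : ℝ)) ^ (2 : ℝ) :=
        ENNReal.rpow_le_rpow (h3.trans h4) (by norm_num)
    _ = ENNReal.ofReal |t - r| * ∫⁻ s in uIoc r t, ‖g s x‖ₑ ^ (2 : ℝ) := by
        rw [ENNReal.mul_rpow_of_nonneg _ _ (by norm_num), ← ENNReal.rpow_mul, ← ENNReal.rpow_mul]
        norm_num
        rw [mul_comm]
    _ ≤ ENNReal.ofReal |t - r| * ∫⁻ s in Ioo 0 T, ‖g s x‖ₑ ^ (2 : ℝ) := by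
        rw [Measure.restrict_congr_set (Ioo_ae_eq_Ioc (a := (0 : ℝ)) (b := T))]
        gcongr

end SpaceTime

/-! ### Convex densities of `p`-growth -/

/-- A jointly measurable density `K z ξ ≥ 0`, convex and `C¹` in `ξ`, with `K z ξ ≤ c |ξ| ^ p`. -/
structure IsGrowthDensity {Z : Type*} [MeasurableSpace Z] (p c : ℝ) (K : Z → ℝ → ℝ) : Prop where
  measurable : Measurable (Function.uncurry K)
  convex : ∀ z, ConvexOn ℝ univ (K z)
  contDiff : ∀ z, ContDiff ℝ 1 (K z)
  nonneg : ∀ z ξ, 0 ≤ K z ξ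
  le : ∀ z ξ, K z ξ ≤ c * |ξ| ^ p

namespace IsGrowthDensity

variable {Z : Type*} [MeasurableSpace Z] {p c : ℝ} {K : Z → ℝ → ℝ}

lemma add_deriv_mul_le (hK : IsGrowthDensity p c K) (z : Z) (x y : ℝ) :
    K z x + deriv (K z) x * (y - x) ≤ K z y := by
  have hd : DifferentiableAt ℝ (K z) x := (hK.contDiff z).differentiable one_ne_zero x
  rcases lt_trichotomy y x with h | rfl | h
  · have h1 := (hK.convex z).slope_le_deriv (mem_univ y) (mem_univ x) h hd
    rw [slope_def_field, div_le_iff₀ (sub_pos.2 h)] at h1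
    linarith
  · simp
  · have h1 := (hK.convex z).deriv_le_slope (mem_univ x) (mem_univ y) h hd
    rw [slope_def_field, le_div_iff₀ (sub_pos.2 h)] at h1
    linarith

/-- For |e| = |ξ| the tangent line gives K'(ξ) e ≤ K(ξ + e) - K(ξ) ≤ c (2|ξ|)^p; the choices e =
±|ξ| bound |K'(ξ)| |ξ|. At ξ = 0 the growth bound forces a minimum. -/
lemma abs_deriv_le (hK : IsGrowthDensity p c K) (hp : 1 < p) (z : Z) (ξ : ℝ) :
    |deriv (K z) ξ| ≤ c * 2 ^ p * |ξ| ^ (p - 1) := by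
  have hp0 : p - 1 ≠ 0 := by linarith
  rcases eq_or_ne ξ 0 with rfl | hξ
  · have h0 : K z 0 = 0 := by
      have := hK.le z 0
      rw [abs_zero, Real.zero_rpow (by linarith), mul_zero] at this
      exact le_antisymm this (hK.nonneg z 0)
    have hmin : IsLocalMin (K z) 0 := Eventually.of_forall fun y => by
      rw [h0]
      exact hK.nonneg z y
    rw [hmin.deriv_eq_zero, abs_zero, Real.zero_rpow hp0, mul_zero]
  · have hpos : 0 < |ξ| := abs_pos.2 hξ
    have hc : 0 ≤ c := by
      have := (hK.nonneg z ξ).trans (hK.le z ξ)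
      have h2 : 0 < |ξ| ^ p := Real.rpow_pos_of_pos hpos p
      exact le_of_mul_le_mul_right (by simpa using this) h2
    have key : ∀ e : ℝ, |e| = |ξ| → deriv (K z) ξ * e ≤ c * 2 ^ p * |ξ| ^ (p - 1) * |ξ| := by
      intro e he
      have h1 := hK.add_deriv_mul_le z ξ (ξ + e)
      have h2 := hK.le z (ξ + e)
      have h3 := hK.nonneg z ξ
      have h4 : |ξ + e| ^ p ≤ (2 * |ξ|) ^ p := by
        refine Real.rpow_le_rpow (abs_nonneg _) ((abs_add_le _ _).trans ?_) (by linarith)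
        rw [he]
        linarith
      have h5 : |ξ| ^ p = |ξ| ^ (p - 1) * |ξ| := by
        rw [← Real.rpow_add_one hpos.ne', sub_add_cancel]
      rw [Real.mul_rpow zero_le_two hpos.le, h5] at h4
      have h6 := mul_le_mul_of_nonneg_left h4 hc
      rw [add_sub_cancel_left] at h1
      linarith
    refine le_of_mul_le_mul_right ?_ hpos
    rcases abs_choice (deriv (K z) ξ) with h | h <;> rw [h]
    · exact key |ξ| (abs_abs ξ)
    · have := key (-|ξ|) (by rw [abs_neg, abs_abs])
      linarith

lemma measurable_deriv (hK : IsGrowthDensity p c K) :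
    Measurable (Function.uncurry fun z => deriv (K z)) := by
  have h1 : Tendsto (fun n : ℕ => (1 : ℝ) / (n + 1)) atTop (𝓝[≠] 0) :=
    tendsto_nhdsWithin_iff.2 ⟨tendsto_one_div_add_atTop_nhds_zero_nat,
      Eventually.of_forall fun n => by
        simp only [mem_compl_iff, mem_singleton_iff]
        positivity⟩
  refine measurable_of_tendsto_metrizable
    (f := fun (n : ℕ) (q : Z × ℝ) => ((1 : ℝ) / (n + 1))⁻¹ •
      (K q.1 (q.2 + 1 / (n + 1)) - K q.1 q.2)) (fun n => ?_) ?_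
  · have h2 : Measurable fun q : Z × ℝ => K q.1 (q.2 + 1 / ((n : ℝ) + 1)) :=
      hK.measurable.comp (measurable_fst.prodMk (measurable_snd.add_const _))
    simp only [smul_eq_mul]
    exact (h2.sub hK.measurable).const_mul _
  · rw [tendsto_pi_nhds]
    rintro ⟨z, ξ⟩
    exact ((hK.contDiff z).differentiable one_ne_zero ξ).hasDerivAt.tendsto_slope_zero.comp h1

end IsGrowthDensity

/-- Testing at rational ξ only means that the null sets of countably many sections have to be
removed from a Carathéodory function. -/
lemma measurable_of_continuous_of_measurable_rat {Z : Type*} [MeasurableSpace Z] {H : Z → ℝ → ℝ}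
    (hc : ∀ z, Continuous (H z)) (hm : ∀ q : ℚ, Measurable fun z => H z q) :
    Measurable (Function.uncurry H) := by
  have h1 : ∀ ξ : ℝ, Measurable fun z => H z ξ := by
    intro ξ
    obtain ⟨x, hx, hlim⟩ := mem_closure_iff_seq_limit.1 (Rat.denseRange_cast (𝕜 := ℝ) ξ)
    choose q hq using hx
    refine measurable_of_tendsto_metrizable (fun n => hm (q n)) ?_
    rw [tendsto_pi_nhds]
    intro z
    simp only [hq]
    exact ((hc z).tendsto ξ).comp hlim
  exact (measurable_uncurry_of_continuous_of_measurable (u := fun ξ z => H z ξ) hc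
    h1).comp measurable_swap

variable {N : ℕ}

/-- Expressed through the weighted difference, H/|x-y|^N becomes a density bounded by |C||ξ|^p with
no singular weight. In both identities the null set of z is chosen before the functions `w` and `φ`,
so they may be applied to functions that vary with time. -/
lemma exists_isGrowthDensity (hN : 1 ≤ N) {s p A C : ℝ} (hp : 1 < p) (hA : 0 < A)
    {H : Sp N → Sp N → ℝ → ℝ} (hH : IsAdmissible s p A H)
    (hC1 : ∀ᵐ z : Sp N × Sp N, ContDiff ℝ 1 (H z.1 z.2))
    (hupper : ∀ᵐ z : Sp N × Sp N, ∀ ξ : ℝ, H z.1 z.2 ξ ≤ C * (|ξ| / ‖z.1 - z.2‖ ^ s) ^ p) :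
    ∃ K : Sp N × Sp N → ℝ → ℝ, IsGrowthDensity p |C| K ∧
      (∀ᵐ z : Sp N × Sp N, ∀ w : Sp N → ℝ,
        H z.1 z.2 (w z.1 - w z.2) / ‖z.1 - z.2‖ ^ N = K z (diffQuot s p w z)) ∧
      (∀ᵐ z : Sp N × Sp N, ∀ w φ : Sp N → ℝ,
        deriv (H z.1 z.2) (w z.1 - w z.2) * (φ z.1 - φ z.2) / ‖z.1 - z.2‖ ^ N
          = deriv (K z) (diffQuot s p w z) * diffQuot s p φ z) := by
  have hN0 : N ≠ 0 := by omega
  have hp0 : p ≠ 0 := by linarith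
  set κ : ℝ := (N : ℝ) / p + s with hκ
  have hq : ∀ᵐ z : Sp N × Sp N, ∀ q : ℚ,
      H z.1 z.2 q = (hH.measurable q).mk _ z :=
    ae_all_iff.2 fun q => (hH.measurable q).ae_eq_mk
  have hall := ((hq.and (hC1.and hH.convex)).and (hH.lower.and hupper))
  obtain ⟨B, hBsub, hBm, hB0⟩ := exists_measurable_superset_of_null hall
  have hgood : ∀ z ∉ B, ((∀ q : ℚ, H z.1 z.2 q = (hH.measurable q).mk _ z) ∧
      ContDiff ℝ 1 (H z.1 z.2) ∧ ConvexOn ℝ univ (H z.1 z.2)) ∧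
      (∀ ξ : ℝ, A * (|ξ| / ‖z.1 - z.2‖ ^ s) ^ p ≤ H z.1 z.2 ξ) ∧
      ∀ ξ : ℝ, H z.1 z.2 ξ ≤ C * (|ξ| / ‖z.1 - z.2‖ ^ s) ^ p := by
    intro z hz
    by_contra h
    exact hz (hBsub h)
  have haeB : ∀ᵐ z : Sp N × Sp N, z ∉ B := by
    rw [ae_iff]
    simpa using hB0
  classical
  -- Zero satisfies every requirement, so overwriting `H` by it on the null set `B` makes the
  -- hypotheses hold everywhere.
  set H' : Sp N × Sp N → ℝ → ℝ := fun z ξ => if z ∈ B then 0 else H z.1 z.2 ξ with hH'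
  have hH'c : ∀ z, ContDiff ℝ 1 (H' z) := by
    intro z
    by_cases hz : z ∈ B
    · simp only [hH', hz, if_true]
      exact contDiff_const
    · simp only [hH', hz, if_false]
      exact (hgood z hz).1.2.1
  have hH'm : Measurable (Function.uncurry H') := by
    refine measurable_of_continuous_of_measurable_rat (fun z => (hH'c z).continuous) fun q => ?_
    have : (fun z => H' z q) = fun z => if z ∈ B then 0 else (hH.measurable q).mk _ z := by
      funext z
      by_cases hz : z ∈ B
      · simp [hH', hz]
      · simp only [hH', hz, if_false]
        exact (hgood z hz).1.1 q
    rw [this]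
    exact Measurable.ite hBm measurable_const (hH.measurable q).measurable_mk
  have hH'conv : ∀ z, ConvexOn ℝ univ (H' z) := by
    intro z
    by_cases hz : z ∈ B
    · simp only [hH', hz, if_true]
      exact convexOn_const 0 convex_univ
    · simp only [hH', hz, if_false]
      exact (hgood z hz).1.2.2
  have hH'0 : ∀ z ξ, 0 ≤ H' z ξ := by
    intro z ξ
    by_cases hz : z ∈ B
    · simp [hH', hz]
    · simp only [hH', hz, if_false]
      exact le_trans (by positivity) ((hgood z hz).2.1 ξ)
  have hH'u : ∀ z ξ, H' z ξ ≤ |C| * (|ξ| / ‖z.1 - z.2‖ ^ s) ^ p := by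
    intro z ξ
    by_cases hz : z ∈ B
    · simp only [hH', hz, if_true]
      positivity
    · simp only [hH', hz, if_false]
      refine ((hgood z hz).2.2 ξ).trans ?_
      gcongr
      exact le_abs_self C
  have hK0 : ∀ z : Sp N × Sp N, ∀ ξ, H' z (ξ * ‖z.1 - z.2‖ ^ κ) / ‖z.1 - z.2‖ ^ N
      ≤ |C| * |ξ| ^ p := by
    intro z ξ
    -- On the diagonal |x-y|^N = 0 because N ≥ 1, and division by zero returns 0. Off it, κ - s =
    -- N/p makes the powers of |x-y| cancel.
    rcases (norm_nonneg (z.1 - z.2)).eq_or_lt with h | h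
    · rw [← h, zero_pow hN0, div_zero]
      positivity
    · rw [div_le_iff₀ (pow_pos h N)]
      refine (hH'u z _).trans (le_of_eq ?_)
      rw [abs_mul, abs_of_pos (Real.rpow_pos_of_pos h κ), mul_div_assoc, ← Real.rpow_sub h,
        Real.mul_rpow (abs_nonneg ξ) (Real.rpow_nonneg h.le _), ← Real.rpow_mul h.le, hκ,
        add_sub_cancel_right, div_mul_cancel₀ _ hp0, Real.rpow_natCast, mul_assoc]
  have hderiv : ∀ z : Sp N × Sp N, ∀ ξ,
      deriv (fun ξ => H' z (ξ * ‖z.1 - z.2‖ ^ κ) / ‖z.1 - z.2‖ ^ N) ξ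
        = deriv (H' z) (ξ * ‖z.1 - z.2‖ ^ κ) * ‖z.1 - z.2‖ ^ κ / ‖z.1 - z.2‖ ^ N := by
    intro z ξ
    have h1 : HasDerivAt (fun ξ : ℝ => ξ * ‖z.1 - z.2‖ ^ κ) (‖z.1 - z.2‖ ^ κ) ξ := by
      simpa using (hasDerivAt_id ξ).mul_const (‖z.1 - z.2‖ ^ κ)
    have h2 := ((hH'c z).differentiable one_ne_zero (ξ * ‖z.1 - z.2‖ ^ κ)).hasDerivAt
    exact ((h2.comp ξ h1).div_const _).deriv
  refine ⟨fun z ξ => H' z (ξ * ‖z.1 - z.2‖ ^ κ) / ‖z.1 - z.2‖ ^ N, ⟨?_, ?_, ?_, ?_, hK0⟩, ?_, ?_⟩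
  · have h3 : Measurable fun q : (Sp N × Sp N) × ℝ => q.2 * ‖q.1.1 - q.1.2‖ ^ κ := by fun_prop
    have h1 : Measurable fun q : (Sp N × Sp N) × ℝ => H' q.1 (q.2 * ‖q.1.1 - q.1.2‖ ^ κ) :=
      hH'm.comp (measurable_fst.prodMk h3)
    have h2 : Measurable fun q : (Sp N × Sp N) × ℝ => ‖q.1.1 - q.1.2‖ ^ N := by fun_prop
    exact h1.div h2
  · intro z
    have h1 := (hH'conv z).comp_linearMap ((‖z.1 - z.2‖ ^ κ) • (LinearMap.id : ℝ →ₗ[ℝ] ℝ))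
    have h2 := h1.smul (c := (‖z.1 - z.2‖ ^ N)⁻¹) (by positivity)
    refine h2.congr (f := _) fun ξ _ => ?_
    simp [div_eq_inv_mul, mul_comm]
  · intro z
    exact ((hH'c z).comp (contDiff_id.mul contDiff_const)).div_const _
  · intro z ξ
    exact div_nonneg (hH'0 _ _) (by positivity)
  · filter_upwards [haeB] with z hz w
    have hHz : H z.1 z.2 = H' z := by simp [hH', hz]
    rw [hHz]
    rcases (norm_nonneg (z.1 - z.2)).eq_or_lt with h | h
    · rw [← h, zero_pow hN0, div_zero, div_zero]
    · rw [diffQuot, ← hκ, div_mul_cancel₀ _ (Real.rpow_pos_of_pos h κ).ne']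
  · filter_upwards [haeB] with z hz w φ
    have hHz : H z.1 z.2 = H' z := by simp [hH', hz]
    rw [hHz, hderiv]
    rcases (norm_nonneg (z.1 - z.2)).eq_or_lt with h | h
    · rw [← h, zero_pow hN0, div_zero, div_zero, zero_mul]
    · have h0 := (Real.rpow_pos_of_pos h κ).ne'
      rw [diffQuot, diffQuot, ← hκ, div_mul_cancel₀ _ h0]
      field_simp

/-! ### Time-dependent functions with values in fractional Sobolev spaces -/

lemma ae_prod_comp_fst {P : Sp N → Prop} (h : ∀ᵐ x, P x) : ∀ᵐ z : Sp N × Sp N, P z.1 :=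
  Measure.quasiMeasurePreserving_fst.ae h

lemma ae_prod_comp_snd {P : Sp N → Prop} (h : ∀ᵐ x, P x) : ∀ᵐ z : Sp N × Sp N, P z.2 :=
  Measure.quasiMeasurePreserving_snd.ae h

lemma aestronglyMeasurable_diffQuot_prod (s p : ℝ) {T : ℝ} {u : ℝ → Sp N → ℝ}
    (hu : AEStronglyMeasurable (fun q : ℝ × Sp N => u q.1 q.2)
      ((volume.restrict (Ioo 0 T)).prod volume)) :
    AEStronglyMeasurable (fun q : ℝ × (Sp N × Sp N) => diffQuot s p (u q.1) q.2)
      ((volume.restrict (Ioo 0 T)).prod volume) := by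
  have hq1 : Measure.QuasiMeasurePreserving (Prod.map (id : ℝ → ℝ) (Prod.fst : Sp N × Sp N → Sp N))
      ((volume.restrict (Ioo 0 T)).prod volume) ((volume.restrict (Ioo 0 T)).prod volume) :=
    QuasiMeasurePreserving.prodMap (.id _) Measure.quasiMeasurePreserving_fst
  have hq2 : Measure.QuasiMeasurePreserving (Prod.map (id : ℝ → ℝ) (Prod.snd : Sp N × Sp N → Sp N))
      ((volume.restrict (Ioo 0 T)).prod volume) ((volume.restrict (Ioo 0 T)).prod volume) :=
    QuasiMeasurePreserving.prodMap (.id _) Measure.quasiMeasurePreserving_snd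
  have h1 := hu.comp_quasiMeasurePreserving hq1
  have h2 := hu.comp_quasiMeasurePreserving hq2
  have h3 : Measurable (fun q : ℝ × (Sp N × Sp N) => ‖q.2.1 - q.2.2‖ ^ ((N : ℝ) / p + s)) := by
    fun_prop
  exact ((h1.sub h2).aemeasurable.div h3.aemeasurable).aestronglyMeasurable

lemma eLpNorm_ofReal_rpow {Y : Type*} [MeasurableSpace Y] {ν : Measure Y} {p : ℝ} (hp : 0 < p)
    (g : Y → ℝ) : eLpNorm g (ENNReal.ofReal p) ν ^ p = ∫⁻ y, ‖g y‖ₑ ^ p ∂ν := by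
  have h0 : ENNReal.ofReal p ≠ 0 := by simpa using hp
  rw [eLpNorm_eq_lintegral_rpow_enorm_toReal h0 ENNReal.ofReal_ne_top,
    ENNReal.toReal_ofReal hp.le, ← ENNReal.rpow_mul, one_div, inv_mul_cancel₀ hp.ne',
    ENNReal.rpow_one]

lemma memLp_prod_iff {X : Type*} [MeasurableSpace X] {μ : Measure X} [SFinite μ] {p T : ℝ}
    (hp : 0 < p) {f : ℝ → X → ℝ}
    (hf : AEStronglyMeasurable (fun q : ℝ × X => f q.1 q.2)
      ((volume.restrict (Ioo 0 T)).prod μ)) :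
    MemLp (fun q : ℝ × X => f q.1 q.2) (ENNReal.ofReal p) ((volume.restrict (Ioo 0 T)).prod μ) ↔
      ∫⁻ t in Ioo 0 T, eLpNorm (f t) (ENNReal.ofReal p) μ ^ p < ⊤ := by
  have h0 : ENNReal.ofReal p ≠ 0 := by simpa using hp
  rw [MemLp, and_iff_right hf,
    eLpNorm_lt_top_iff_lintegral_rpow_enorm_lt_top h0 ENNReal.ofReal_ne_top,
    ENNReal.toReal_ofReal hp.le, lintegral_prod _ (hf.enorm.pow_const _)]
  simp only [eLpNorm_ofReal_rpow hp]

/-- By Tonelli and (a+b)^p ≤ 2^(p-1)(a^p + b^p), membership reduces to two scalar L^p conditions on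
product spaces, where dominated convergence and Hölder apply. -/
lemma memLpW_iff {s p T : ℝ} (hp : 1 < p) {u : ℝ → Sp N → ℝ} :
    MemLpW s p T u ↔
      MemLp (fun q : ℝ × Sp N => u q.1 q.2) (ENNReal.ofReal p)
        ((volume.restrict (Ioo 0 T)).prod volume) ∧
      MemLp (fun q : ℝ × (Sp N × Sp N) => diffQuot s p (u q.1) q.2) (ENNReal.ofReal p)
        ((volume.restrict (Ioo 0 T)).prod volume) := by
  have hp0 : 0 < p := by linarith
  constructor
  · rintro ⟨h1, h2⟩
    rw [memLp_prod_iff hp0 h1,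
      memLp_prod_iff (f := fun t => diffQuot s p (u t)) hp0
        (aestronglyMeasurable_diffQuot_prod s p h1)]
    exact ⟨(lintegral_mono fun t => ENNReal.rpow_le_rpow le_self_add hp0.le).trans_lt h2,
      (lintegral_mono fun t => ENNReal.rpow_le_rpow le_add_self hp0.le).trans_lt h2⟩
  · rintro ⟨h1, h2⟩
    refine ⟨h1.1, ?_⟩
    have hm : AEMeasurable (fun t => eLpNorm (u t) (ENNReal.ofReal p) volume ^ p)
        (volume.restrict (Ioo 0 T)) := by
      simp only [eLpNorm_ofReal_rpow hp0]
      exact (h1.1.enorm.pow_const p).lintegral_prod_right'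
    rw [memLp_prod_iff hp0 h1.1] at h1
    rw [memLp_prod_iff (f := fun t => diffQuot s p (u t)) hp0 h2.1] at h2
    refine (lintegral_mono fun t =>
      ENNReal.rpow_add_le_mul_rpow_add_rpow _ _ hp.le).trans_lt ?_
    rw [lintegral_const_mul' _ _ (by finiteness), lintegral_add_left' hm]
    exact ENNReal.mul_lt_top (by finiteness) (ENNReal.add_lt_top.2 ⟨h1, h2⟩)

lemma memLp_mul_prod {X : Type*} [MeasurableSpace X] {μ : Measure X} [SFinite μ] {T M : ℝ}
    {r : ℝ≥0∞} {ζ : ℝ → ℝ} {w : X → ℝ} (hζ : Measurable ζ) (hM : ∀ t, |ζ t| ≤ M)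
    (hw : MemLp w r μ) :
    MemLp (fun q : ℝ × X => ζ q.1 * w q.2) r ((volume.restrict (Ioo 0 T)).prod μ) := by
  have h1 : MemLp (fun q : ℝ × X => w q.2) r ((volume.restrict (Ioo 0 T)).prod μ) :=
    hw.comp_snd _
  exact h1.of_le_mul (c := M) ((hζ.comp measurable_fst).aestronglyMeasurable.mul h1.1)
    (ae_of_all _ fun q => by
      rw [norm_mul]
      exact mul_le_mul_of_nonneg_right (hM q.1) (norm_nonneg _))

lemma MemLpW.add {s p T : ℝ} (hp : 1 < p) {u v : ℝ → Sp N → ℝ} (hu : MemLpW s p T u)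
    (hv : MemLpW s p T v) : MemLpW s p T (fun t x => u t x + v t x) := by
  rw [memLpW_iff hp] at *
  refine ⟨hu.1.add hv.1, (hu.2.add hv.2).ae_eq (ae_of_all _ fun q => ?_)⟩
  exact (congrFun (diffQuot_add s p (u q.1) (v q.1)) q.2).symm

lemma memLpW_mul {s p T M : ℝ} (hp : 1 < p) {ζ : ℝ → ℝ} {w : Sp N → ℝ} (hζ : Measurable ζ)
    (hM : ∀ t, |ζ t| ≤ M) (hw : MemW s p w) : MemLpW s p T (fun t x => ζ t * w x) := by
  rw [memW_iff] at hw
  rw [memLpW_iff hp]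
  refine ⟨memLp_mul_prod hζ hM hw.1, (memLp_mul_prod hζ hM hw.2).ae_eq (ae_of_all _ fun q => ?_)⟩
  exact (congrFun (diffQuot_smul s p (ζ q.1) w) q.2).symm

/-- The exponential average in time of `u` with initial value `u₀`. -/
def timeAvg (h : ℝ) (u₀ : Sp N → ℝ) (u : ℝ → Sp N → ℝ) (t : ℝ) (x : Sp N) : ℝ :=
  expAvg h (u₀ x) (fun s => u s x) t

/-- Averaging is linear and acts on time alone, so it commutes with differences in space. This lets
Jensen's inequality act at each pair (x,y). -/
lemma diffQuot_timeAvg {s p T h : ℝ} {u₀ : Sp N → ℝ} {u : ℝ → Sp N → ℝ} {z : Sp N × Sp N}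
    (h1 : IntegrableOn (fun t => u t z.1) (Ioo 0 T))
    (h2 : IntegrableOn (fun t => u t z.2) (Ioo 0 T)) {t : ℝ} (ht : t ∈ Icc 0 T) :
    diffQuot s p (timeAvg h u₀ u t) z
      = expAvg h (diffQuot s p u₀ z) (fun t => diffQuot s p (u t) z) t := by
  have h3 := expAvg_const_mul h (u₀ z.1 - u₀ z.2) (‖z.1 - z.2‖ ^ ((N : ℝ) / p + s))⁻¹
    (fun t => u t z.1 - u t z.2) t
  rw [expAvg_sub h1 h2 _ _ ht] at h3
  simp only [diffQuot, timeAvg, div_eq_inv_mul] at h3 ⊢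
  exact h3.symm

lemma ae_diffQuot_timeAvg {s p T : ℝ} (h : ℝ) (u₀ : Sp N → ℝ) {u : ℝ → Sp N → ℝ}
    (hi : ∀ᵐ x, IntegrableOn (fun t => u t x) (Ioo 0 T)) :
    ∀ᵐ q : ℝ × (Sp N × Sp N) ∂((volume.restrict (Ioo 0 T)).prod volume),
      diffQuot s p (timeAvg h u₀ u q.1) q.2
        = expAvg h (diffQuot s p u₀ q.2) (fun t => diffQuot s p (u t) q.2) q.1 := by
  have hI : ∀ᵐ q : ℝ × (Sp N × Sp N) ∂((volume.restrict (Ioo 0 T)).prod volume), q.1 ∈ Ioo 0 T :=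
    Measure.quasiMeasurePreserving_fst.ae (ae_restrict_mem measurableSet_Ioo)
  filter_upwards [hI, ae_prod_of_ae_snd ((ae_prod_comp_fst hi).and (ae_prod_comp_snd hi))]
    with q hq1 hq2
  exact diffQuot_timeAvg hq2.1 hq2.2 (Ioo_subset_Icc_self hq1)

lemma MemLpW.ae_integrableOn {s p T : ℝ} (hp : 1 < p) {u : ℝ → Sp N → ℝ} (hu : MemLpW s p T u) :
    ∀ᵐ x, IntegrableOn (fun t => u t x) (Ioo 0 T) :=
  ae_integrableOn_section (by simpa using hp.le) ENNReal.ofReal_ne_top ((memLpW_iff hp).1 hu).1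

lemma MemLpW.timeAvg {s p T h : ℝ} (hp : 1 < p) (hh : 0 < h) (hT : 0 < T) {u₀ : Sp N → ℝ}
    {u : ℝ → Sp N → ℝ} (hu₀ : MemW s p u₀) (hu : MemLpW s p T u) :
    MemLpW s p T (timeAvg h u₀ u) := by
  have hi := hu.ae_integrableOn hp
  rw [memW_iff] at hu₀
  rw [memLpW_iff hp] at hu ⊢
  refine ⟨memLp_expAvg hh hT hp.le hu₀.1 hu.1,
    (memLp_expAvg (f := fun t => diffQuot s p (u t)) hh hT hp.le hu₀.2 hu.2).ae_eq ?_⟩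
  filter_upwards [ae_diffQuot_timeAvg h u₀ hi] with q hq
  exact hq.symm

/-! ### Energies in terms of densities -/

section Energy

variable {s p c : ℝ} {H : Sp N → Sp N → ℝ → ℝ} {K : Sp N × Sp N → ℝ → ℝ}

lemma energy_eq (hKH : ∀ᵐ z : Sp N × Sp N, ∀ w : Sp N → ℝ,
      H z.1 z.2 (w z.1 - w z.2) / ‖z.1 - z.2‖ ^ N = K z (diffQuot s p w z)) (w : Sp N → ℝ) :
    energy H w = ∫⁻ z, ENNReal.ofReal (K z (diffQuot s p w z)) := by
  refine lintegral_congr_ae ?_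
  filter_upwards [hKH] with z hz
  rw [hz w]

lemma IsGrowthDensity.aestronglyMeasurable_comp (hK : IsGrowthDensity p c K) {T : ℝ}
    {f : ℝ × (Sp N × Sp N) → ℝ}
    (hf : AEStronglyMeasurable f ((volume.restrict (Ioo 0 T)).prod volume)) :
    AEStronglyMeasurable (fun q : ℝ × (Sp N × Sp N) => K q.2 (f q))
      ((volume.restrict (Ioo 0 T)).prod volume) :=
  (hK.measurable.comp_aemeasurable
    (measurable_snd.aemeasurable.prodMk hf.aemeasurable)).aestronglyMeasurable

lemma lintegral_energy_eq (hK : IsGrowthDensity p c K) (hKH : ∀ᵐ z : Sp N × Sp N, ∀ w : Sp N → ℝ,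
      H z.1 z.2 (w z.1 - w z.2) / ‖z.1 - z.2‖ ^ N = K z (diffQuot s p w z)) {T : ℝ}
    {u : ℝ → Sp N → ℝ} (hu : AEStronglyMeasurable (fun q : ℝ × Sp N => u q.1 q.2)
      ((volume.restrict (Ioo 0 T)).prod volume)) :
    ∫⁻ t in Ioo 0 T, energy H (u t)
      = ∫⁻ q : ℝ × (Sp N × Sp N), ENNReal.ofReal (K q.2 (diffQuot s p (u q.1) q.2))
        ∂((volume.restrict (Ioo 0 T)).prod volume) := by
  rw [lintegral_prod _ (hK.aestronglyMeasurable_comp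
    (aestronglyMeasurable_diffQuot_prod s p hu)).aemeasurable.ennreal_ofReal]
  simp only [energy_eq hKH]

lemma lintegral_energy_timeAvg_le (hp : 1 < p) (hK : IsGrowthDensity p c K)
    (hKH : ∀ᵐ z : Sp N × Sp N, ∀ w : Sp N → ℝ,
      H z.1 z.2 (w z.1 - w z.2) / ‖z.1 - z.2‖ ^ N = K z (diffQuot s p w z)) {T h : ℝ}
    (hT : 0 < T) (hh : 0 < h) {u₀ : Sp N → ℝ} {u : ℝ → Sp N → ℝ} (hu₀ : MemW s p u₀)
    (hu : MemLpW s p T u) :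
    ∫⁻ t in Ioo 0 T, energy H (timeAvg h u₀ u t)
      ≤ ENNReal.ofReal h * energy H u₀ + ∫⁻ t in Ioo 0 T, energy H (u t) := by
  have hi := hu.ae_integrableOn hp
  rw [lintegral_energy_eq hK hKH (hu.timeAvg hp hh hT hu₀).1, lintegral_energy_eq hK hKH hu.1,
    energy_eq hKH]
  have h1 := lintegral_comp_expAvg_prod_le (Φ := K) (f := fun t => diffQuot s p (u t)) hh hT
    (aestronglyMeasurable_diffQuot s p hu₀.1) (aestronglyMeasurable_diffQuot_prod s p hu.1)
    (ae_integrableOn_section (by simpa using hp.le) ENNReal.ofReal_ne_top ((memLpW_iff hp).1 hu).2)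
    hK.measurable hK.nonneg (fun z => exists_forall_add_mul_sub_le (hK.convex z))
  refine le_trans (le_of_eq (lintegral_congr_ae ?_)) h1
  filter_upwards [ae_diffQuot_timeAvg h u₀ hi] with q hq
  rw [hq]

end Energy

/-! ### Preliminaries on the cylinder -/

/-- Once the energy of the comparison function is finite, the extended inequality becomes a real
one; the finiteness of the other energy is part of the conclusion. -/
lemma toReal_le_of_coe_le_coe_add {a b : ℝ≥0∞} {r : ℝ} (hb : b ≠ ⊤)
    (h : (a : EReal) ≤ (b : EReal) + (r : EReal)) : a ≠ ⊤ ∧ a.toReal ≤ b.toReal + r := by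
  lift b to NNReal using hb
  have h1 : ((b : ℝ≥0∞) : EReal) + (r : EReal) = (((b : ℝ) + r : ℝ) : EReal) := by
    rw [EReal.coe_add]
    rfl
  rw [h1] at h
  have ha : a ≠ ⊤ := by
    rintro rfl
    simp only [EReal.coe_ennreal_top, top_le_iff] at h
    exact EReal.coe_ne_top _ h
  refine ⟨ha, ?_⟩
  lift a to NNReal using ha
  have h2 : ((a : ℝ) : EReal) ≤ (((b : ℝ) + r : ℝ) : EReal) := h
  simpa using EReal.coe_le_coe_iff.1 h2

/-- Iterated null statements combine into a joint one only under measurability, used here through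
the integral of |g|. -/
lemma ae_prod_eq_zero_of_ae_ae {X : Type*} [MeasurableSpace X] {μ : Measure X} [SFinite μ] {T : ℝ}
    {g : ℝ × X → ℝ} (hg : AEStronglyMeasurable g ((volume.restrict (Ioo 0 T)).prod μ))
    (h : ∀ᵐ t ∂(volume.restrict (Ioo 0 T)), ∀ᵐ x ∂μ, g (t, x) = 0) :
    ∀ᵐ q ∂((volume.restrict (Ioo 0 T)).prod μ), g q = 0 := by
  have h1 : ∫⁻ q, ‖g q‖ₑ ∂((volume.restrict (Ioo 0 T)).prod μ) = 0 := by
    rw [lintegral_prod _ hg.enorm]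
    refine (lintegral_congr_ae (g := fun _ => 0) ?_).trans lintegral_zero
    filter_upwards [h] with t ht
    refine (lintegral_congr_ae (g := fun _ => 0) ?_).trans lintegral_zero
    filter_upwards [ht] with x hx
    simp [hx]
  rw [lintegral_eq_zero_iff' hg.enorm] at h1
  filter_upwards [h1] with q hq
  simpa using hq

lemma cylinder_absolutelyContinuous (Ω : Set (Sp N)) (T : ℝ) :
    cylinder Ω T ≪ (volume.restrict (Ioo 0 T)).prod volume :=
  Measure.AbsolutelyContinuous.rfl.prod Measure.restrict_le_self.absolutelyContinuous

lemma ae_cylinder_mem_Ioo (Ω : Set (Sp N)) (T : ℝ) : ∀ᵐ q ∂(cylinder Ω T), q.1 ∈ Ioo 0 T :=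
  Measure.quasiMeasurePreserving_fst.ae (ae_restrict_mem measurableSet_Ioo)

instance (Ω : Set (Sp N)) (T : ℝ) [IsFiniteMeasure (volume.restrict Ω)] :
    IsFiniteMeasure (cylinder Ω T) := by
  unfold cylinder
  infer_instance

namespace IsTestFunction

variable {Ω : Set (Sp N)} {T : ℝ} {φ : ℝ → Sp N → ℝ}

lemma eq_zero (hφ : IsTestFunction Ω T φ) {t : ℝ} {x : Sp N} (h : ¬ (t ∈ Ioo 0 T ∧ x ∈ Ω)) :
    φ t x = 0 := by
  by_contra h0
  exact h (hφ.2.2 (subset_tsupport _ (show (t, x) ∈ Function.support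
    (fun q : ℝ × Sp N => φ q.1 q.2) from h0)))

lemma contDiff_left (hφ : IsTestFunction Ω T φ) (x : Sp N) : ContDiff ℝ 1 fun t => φ t x :=
  (hφ.1.of_le (by exact_mod_cast le_top)).comp (contDiff_id.prodMk contDiff_const)

lemma deriv_eq (hφ : IsTestFunction Ω T φ) (q : ℝ × Sp N) :
    deriv (fun t => φ t q.2) q.1
      = fderiv ℝ (fun q : ℝ × Sp N => φ q.1 q.2) q ((1 : ℝ), (0 : Sp N)) := by
  have h1 : HasDerivAt (fun t : ℝ => (t, q.2)) ((1 : ℝ), (0 : Sp N)) q.1 :=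
    (hasDerivAt_id q.1).prodMk (hasDerivAt_const q.1 q.2)
  have h2 : HasFDerivAt (fun q : ℝ × Sp N => φ q.1 q.2) _ (q.1, q.2) :=
    (hφ.1.differentiable (by simp) q).hasFDerivAt
  exact (h2.comp_hasDerivAt q.1 h1).deriv

lemma continuous_deriv (hφ : IsTestFunction Ω T φ) :
    Continuous fun q : ℝ × Sp N => deriv (fun t => φ t q.2) q.1 := by
  simp only [hφ.deriv_eq]
  exact (hφ.1.continuous_fderiv (by simp)).clm_apply continuous_const

lemma exists_bound (hφ : IsTestFunction Ω T φ) : ∃ M, ∀ q : ℝ × Sp N, ‖φ q.1 q.2‖ ≤ M :=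
  hφ.2.1.exists_bound_of_continuous hφ.1.continuous

lemma exists_bound_deriv (hφ : IsTestFunction Ω T φ) :
    ∃ M, ∀ q : ℝ × Sp N, ‖deriv (fun t => φ t q.2) q.1‖ ≤ M := by
  refine HasCompactSupport.exists_bound_of_continuous ?_ hφ.continuous_deriv
  simp only [hφ.deriv_eq]
  exact (hφ.2.1.fderiv (𝕜 := ℝ)).comp_left (g := fun L => L ((1 : ℝ), (0 : Sp N))) rfl

end IsTestFunction

/-- Measurability at every time, endpoints included; joint measurability alone would give it for
almost every time only. -/
lemma aestronglyMeasurable_timeAvg_section {X : Type*} [MeasurableSpace X] {μ : Measure X}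
    [SFinite μ] {T h : ℝ} {f₀ : X → ℝ} {f : ℝ → X → ℝ} (hf₀ : AEStronglyMeasurable f₀ μ)
    (hf : AEStronglyMeasurable (fun q : ℝ × X => f q.1 q.2)
      ((volume.restrict (Ioo 0 T)).prod μ)) {t : ℝ} (ht : t ∈ Icc 0 T) :
    AEStronglyMeasurable (fun x => expAvg h (f₀ x) (fun s => f s x) t) μ := by
  have h1 : AEStronglyMeasurable (fun q : ℝ × X => Real.exp (q.1 / h) * f q.1 q.2)
      ((volume.restrict (Ioc 0 t)).prod μ) := by
    refine (by fun_prop : Measurable fun q : ℝ × X =>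
      Real.exp (q.1 / h)).aestronglyMeasurable.mul (hf.mono_ac ?_)
    rw [Measure.restrict_congr_set (Ioo_ae_eq_Ioc (a := (0 : ℝ)) (b := T))]
    exact (Measure.restrict_mono_set volume
      (Ioc_subset_Ioc_right ht.2)).absolutelyContinuous.prod Measure.AbsolutelyContinuous.rfl
  simp only [expAvg, intervalIntegral.integral_of_le ht.1]
  exact (hf₀.add (h1.prod_swap.integral_prod_right'.const_mul _)).const_mul _

/-! ### Exponential averages as comparison functions -/

/-- The time derivative is read off the equation h ∂_t v = u - v, the integrability comes from
Jensen's inequality, and the continuity in L²(Ω) from the Hölder bound. The function `u` need not be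
a solution, so perturbations and constants are covered. -/
lemma isComparison_timeAvg {Ω : Set (Sp N)} [IsFiniteMeasure (volume.restrict Ω)] {s p T h : ℝ}
    (hp : 1 < p) (hT : 0 < T) (hh : 0 < h) {u₀ : Sp N → ℝ} {u : ℝ → Sp N → ℝ}
    (hu₀ : MemW s p u₀) (hu₀' : MemLp u₀ 2 (volume.restrict Ω)) (hu : MemLpW s p T u)
    (hu' : MemLp (fun q : ℝ × Sp N => u q.1 q.2) 2 (cylinder Ω T))
    (hb : ∀ᵐ t ∂(volume.restrict (Ioo 0 T)), ∀ᵐ x, x ∉ Ω → u t x - u₀ x = 0)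
    (hΩ : MeasurableSet Ω) :
    IsComparison Ω s p u₀ T (timeAvg h u₀ u) (fun t x => (u t x - timeAvg h u₀ u t x) / h) := by
  have hi := hu.ae_integrableOn hp
  have hiΩ : ∀ᵐ x ∂(volume.restrict Ω), IntegrableOn (fun t => u t x) (Ioo 0 T) :=
    ae_restrict_of_ae hi
  have htwo : ENNReal.ofReal 2 = 2 := by simp
  have hv2 : MemLp (fun q : ℝ × Sp N => timeAvg h u₀ u q.1 q.2) 2 (cylinder Ω T) := by
    have := memLp_expAvg (μ := volume.restrict Ω) (p := 2) (f := u) (f₀ := u₀) hh hT one_le_two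
      (by rwa [htwo]) (by rw [htwo]; exact hu')
    rwa [htwo] at this
  have hg2 : MemLp (fun q : ℝ × Sp N => (u q.1 q.2 - timeAvg h u₀ u q.1 q.2) / h) 2
      (cylinder Ω T) := by
    simp only [div_eq_inv_mul]
    exact (hu'.sub hv2).const_mul h⁻¹
  have hdiff : ∀ r ∈ Icc 0 T, ∀ t ∈ Icc 0 T,
      eLpNorm (timeAvg h u₀ u t - timeAvg h u₀ u r) 2 (volume.restrict Ω)
        ≤ ENNReal.ofReal |t - r| ^ (1 / 2 : ℝ) *
          eLpNorm (fun q : ℝ × Sp N => (u q.1 q.2 - timeAvg h u₀ u q.1 q.2) / h) 2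
            (cylinder Ω T) := by
    intro r hr t ht
    refine eLpNorm_sub_le_of_eq_integral
      (g := fun t x => (u t x - timeAvg h u₀ u t x) / h) hr ht hg2.1 ?_
    filter_upwards [hiΩ] with x hx
    exact expAvg_sub_eq_integral hx hr ht
  have hmeas : ∀ t ∈ Icc 0 T, AEStronglyMeasurable (timeAvg h u₀ u t) (volume.restrict Ω) :=
    fun t ht => aestronglyMeasurable_timeAvg_section hu₀'.1 hu'.1 ht
  have hzero : timeAvg h u₀ u 0 = u₀ := by
    funext x
    simp [timeAvg]
  refine ⟨hu.timeAvg hp hh hT hu₀, ⟨?_, ?_⟩, ⟨fun t ht => ?_, fun r hr => ?_⟩, hg2, ?_⟩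
  · have h1 := (hu.timeAvg hp hh hT hu₀).add hp (memLpW_mul (T := T) (ζ := fun _ => -1) (M := 1) hp
      measurable_const (fun _ => by simp) hu₀)
    simp only [neg_one_mul, ← sub_eq_add_neg] at h1
    exact h1
  -- The boundary condition holds for a.e. t and then a.e. x. Averaging in time needs the opposite
  -- order, reached through a measurable function on the product that vanishes on Ω.
  · have h1 : AEStronglyMeasurable (fun q : ℝ × Sp N => Ωᶜ.indicator (fun x => u q.1 x - u₀ x) q.2)
        ((volume.restrict (Ioo 0 T)).prod volume) := by
      have h2 : (fun q : ℝ × Sp N => Ωᶜ.indicator (fun x => u q.1 x - u₀ x) q.2)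
          = (Prod.snd ⁻¹' Ωᶜ).indicator (fun q : ℝ × Sp N => u q.1 q.2 - u₀ q.2) := by
        funext q
        by_cases h : q.2 ∈ Ω <;> simp [indicator, h]
      rw [h2]
      exact (hu.1.sub hu₀.1.comp_snd).indicator (measurable_snd hΩ.compl)
    have h3 := ae_ae_of_ae_prod_swap (ae_prod_eq_zero_of_ae_ae h1 (by
      filter_upwards [hb] with t ht
      filter_upwards [ht] with x hx
      by_cases hxΩ : x ∈ Ω
      · simp [hxΩ]
      · simpa [hxΩ] using hx hxΩ))
    refine (ae_restrict_iff' measurableSet_Ioo).2 (ae_of_all _ fun t ht => ?_)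
    filter_upwards [h3] with x hx hxΩ
    -- On such a time line `u` equals the constant `u₀ x`, which is also the initial value, so the
    -- average is that constant.
    have h4 : (fun t => u t x) =ᵐ[volume.restrict (Ioo 0 T)] fun _ => u₀ x := by
      filter_upwards [hx] with t ht
      simpa [hxΩ, sub_eq_zero] using ht
    simp only [Pi.sub_apply, timeAvg]
    rw [expAvg_congr h4 (Ioo_subset_Icc_self ht), expAvg_const hh.ne', sub_self]
  · have h1 := hdiff 0 (left_mem_Icc.2 hT.le) t ht
    rw [hzero] at h1
    have h2 : MemLp (timeAvg h u₀ u t - u₀) 2 (volume.restrict Ω) :=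
      ⟨(hmeas t ht).sub hu₀'.1, h1.trans_lt
        (ENNReal.mul_lt_top (ENNReal.rpow_lt_top_of_nonneg (by norm_num) (by simp)) hg2.2)⟩
    simpa using h2.add hu₀'
  · have h1 : Tendsto (fun t : ℝ => ENNReal.ofReal |t - r| ^ (1 / 2 : ℝ) *
        eLpNorm (fun q : ℝ × Sp N => (u q.1 q.2 - timeAvg h u₀ u q.1 q.2) / h) 2
          (cylinder Ω T)) (𝓝[Icc 0 T] r) (𝓝 0) := by
      have h2 : Tendsto (fun t : ℝ => ENNReal.ofReal |t - r|) (𝓝[Icc 0 T] r) (𝓝 0) := by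
        have h3 : Tendsto (fun t : ℝ => |t - r|) (𝓝 r) (𝓝 0) := by
          have h4 : Continuous fun t : ℝ => |t - r| := by fun_prop
          simpa using h4.tendsto r
        simpa using (ENNReal.tendsto_ofReal h3).mono_left nhdsWithin_le_nhds
      have h5 := h2.ennrpow_const (1 / 2 : ℝ)
      rw [ENNReal.zero_rpow_of_pos (by norm_num)] at h5
      simpa using ENNReal.Tendsto.mul_const h5 (Or.inr hg2.2.ne)
    refine tendsto_of_tendsto_of_tendsto_of_le_of_le' tendsto_const_nhds h1
      (Eventually.of_forall fun _ => zero_le) ?_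
    filter_upwards [self_mem_nhdsWithin] with t ht
    exact hdiff r hr t ht
  · intro φ hφ
    obtain ⟨M, hM⟩ := hφ.exists_bound
    obtain ⟨M', hM'⟩ := hφ.exists_bound_deriv
    exact integral_expAvg_mul_deriv_prod hT hiΩ hφ.contDiff_left
      (fun x => hφ.eq_zero (by simp)) (fun x => hφ.eq_zero (by simp))
      ((hv2.integrable one_le_two).mul_bdd (c := M') hφ.continuous_deriv.aestronglyMeasurable
        (ae_of_all _ hM'))
      ((hg2.integrable one_le_two).mul_bdd (c := M) hφ.1.continuous.aestronglyMeasurable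
        (ae_of_all _ hM))

/-! ### First consequences of the variational inequality -/

lemma timeAvg_const {h : ℝ} (hh : h ≠ 0) (u₀ : Sp N → ℝ) (t : ℝ) :
    timeAvg h u₀ (fun _ => u₀) t = u₀ := by
  funext x
  exact expAvg_const hh _ _

lemma memLpW_const {s p T : ℝ} (hp : 1 < p) {w : Sp N → ℝ} (hw : MemW s p w) :
    MemLpW s p T (fun _ => w) := by
  have h1 := memLpW_mul (T := T) (ζ := fun _ => 1) (M := 1) hp measurable_const
    (fun _ => by simp) hw
  simpa only [one_mul] using h1

lemma isComparison_const {Ω : Set (Sp N)} [IsFiniteMeasure (volume.restrict Ω)]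
    (hΩ : MeasurableSet Ω) {s p T : ℝ} (hp : 1 < p) (hT : 0 < T) {u₀ : Sp N → ℝ}
    (hu₀ : MemW s p u₀) (hu₀' : MemLp u₀ 2 (volume.restrict Ω)) :
    IsComparison Ω s p u₀ T (fun _ => u₀) (fun _ _ => 0) := by
  -- The scale 1 is immaterial: a constant is its own average.
  have h1 := isComparison_timeAvg (T := T) (Ω := Ω) hp hT one_pos hu₀ hu₀' (memLpW_const hp hu₀)
    (hu₀'.comp_snd _) (by simp) hΩ
  have h2 : timeAvg 1 u₀ (fun _ => u₀) = fun _ => u₀ :=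
    funext fun t => timeAvg_const one_ne_zero u₀ t
  simpa [h2] using h1

lemma MemLpW.aestronglyMeasurable_cylinder {Ω : Set (Sp N)} {s p T : ℝ} {u : ℝ → Sp N → ℝ}
    (hu : MemLpW s p T u) :
    AEStronglyMeasurable (fun q : ℝ × Sp N => u q.1 q.2) (cylinder Ω T) :=
  hu.1.mono_ac (cylinder_absolutelyContinuous Ω T)

namespace IsVariationalSolution

variable {Ω : Set (Sp N)} [IsFiniteMeasure (volume.restrict Ω)] {s p : ℝ}
  {H : Sp N → Sp N → ℝ → ℝ} {u₀ : Sp N → ℝ} {u : ℝ → Sp N → ℝ}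

/-- Comparison with v = u₀: the time derivative and the initial term vanish, and the energy of u is
nonnegative. The bound controls u in L² of the cylinder and identifies its initial value. -/
lemma integral_sq_sub_le (hu : IsVariationalSolution Ω s p H u₀ u) (hΩ : MeasurableSet Ω)
    (hp : 1 < p) (hu₀ : IsData Ω s p H u₀) {T : ℝ} (hT : 0 < T) :
    ∫ x in Ω, (u₀ x - u T x) ^ 2 ≤ 2 * T * (energy H u₀).toReal := by
  have h1 := hu.inequality T hT _ _ (isComparison_const hΩ hp hT hu₀.memW hu₀.memL2)
  have h2 : ∫⁻ _ in Ioo 0 T, energy H u₀ = ENNReal.ofReal T * energy H u₀ := by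
    rw [setLIntegral_const, Real.volume_Ioo, sub_zero, mul_comm]
  rw [h2] at h1
  obtain ⟨-, h3⟩ := toReal_le_of_coe_le_coe_add
    (ENNReal.mul_lt_top ENNReal.ofReal_lt_top hu₀.energy_lt_top).ne h1
  simp only [zero_mul, integral_zero, sub_self, ne_eq, OfNat.ofNat_ne_zero, not_false_eq_true,
    zero_pow, mul_zero, add_zero, zero_sub, ENNReal.toReal_mul, ENNReal.toReal_ofReal hT.le] at h3
  have h4 := ENNReal.toReal_nonneg (a := ∫⁻ t in Ioo 0 T, energy H (u t))
  linarith

lemma eLpNorm_sub_sq_le (hu : IsVariationalSolution Ω s p H u₀ u) (hΩ : MeasurableSet Ω)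
    (hp : 1 < p) (hu₀ : IsData Ω s p H u₀) {t : ℝ} (ht : 0 < t) :
    eLpNorm (u t - u₀) (ENNReal.ofReal 2) (volume.restrict Ω) ^ (2 : ℝ)
      ≤ ENNReal.ofReal (2 * t * (energy H u₀).toReal) := by
  have hm : MemLp (fun x => u₀ x - u t x) 2 (volume.restrict Ω) :=
    hu₀.memL2.sub ((hu.continuousInL2 t ht).1 t (right_mem_Icc.2 ht.le))
  have h1 : ∀ x, ‖(u t - u₀) x‖ₑ ^ (2 : ℝ) = ENNReal.ofReal ((u₀ x - u t x) ^ 2) := fun x => by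
    rw [Real.enorm_eq_ofReal_abs, ENNReal.ofReal_rpow_of_nonneg (abs_nonneg _) zero_le_two,
      Pi.sub_apply, abs_sub_comm, Real.rpow_two, sq_abs]
  rw [eLpNorm_ofReal_rpow two_pos]
  simp only [h1]
  rw [← ofReal_integral_eq_lintegral_ofReal hm.integrable_sq (ae_of_all _ fun x => sq_nonneg _)]
  exact ENNReal.ofReal_le_ofReal (hu.integral_sq_sub_le hΩ hp hu₀ ht)

lemma memLp_two_cylinder (hu : IsVariationalSolution Ω s p H u₀ u) (hΩ : MeasurableSet Ω)
    (hp : 1 < p) (hu₀ : IsData Ω s p H u₀) {T : ℝ} (hT : 0 < T) :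
    MemLp (fun q : ℝ × Sp N => u q.1 q.2) 2 (cylinder Ω T) := by
  have h2 : MemLp (fun q : ℝ × Sp N => u₀ q.2) 2 (cylinder Ω T) := hu₀.memL2.comp_snd _
  have hm : AEStronglyMeasurable (fun q : ℝ × Sp N => (u q.1 - u₀) q.2) (cylinder Ω T) :=
    (MemLpW.aestronglyMeasurable_cylinder (hu.memLpW T hT)).sub h2.1
  have h1 : MemLp (fun q : ℝ × Sp N => (u q.1 - u₀) q.2) (ENNReal.ofReal 2) (cylinder Ω T) := by
    refine (memLp_prod_iff (f := fun t => u t - u₀) two_pos hm).2 ?_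
    calc ∫⁻ t in Ioo 0 T, eLpNorm (u t - u₀) (ENNReal.ofReal 2) (volume.restrict Ω) ^ (2 : ℝ)
        ≤ ∫⁻ t in Ioo 0 T, ENNReal.ofReal (2 * T * (energy H u₀).toReal) := by
          refine setLIntegral_mono_ae' measurableSet_Ioo (ae_of_all _ fun t ht => ?_)
          refine (hu.eLpNorm_sub_sq_le hΩ hp hu₀ ht.1).trans (ENNReal.ofReal_le_ofReal ?_)
          have := ENNReal.toReal_nonneg (a := energy H u₀)
          have := ht.2.le
          gcongr
      _ < ⊤ := by
          rw [setLIntegral_const]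
          exact ENNReal.mul_lt_top ENNReal.ofReal_lt_top (by simp)
  rw [show ENNReal.ofReal 2 = 2 by simp] at h1
  exact (h1.add h2).ae_eq (ae_of_all _ fun q => by simp)

/-- As t ↓ 0, u(t) tends in L²(Ω) to u(0) by continuity and to u₀ by comparison with the constant.
-/
lemma ae_eq_initial (hu : IsVariationalSolution Ω s p H u₀ u) (hΩ : MeasurableSet Ω)
    (hp : 1 < p) (hu₀ : IsData Ω s p H u₀) : ∀ᵐ x ∂(volume.restrict Ω), u 0 x = u₀ x := by
  have hc := hu.continuousInL2 1 one_pos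
  have hm0 : MemLp (u 0) 2 (volume.restrict Ω) := hc.1 0 (by simp)
  have hsub : 𝓝[Ioc 0 1] (0 : ℝ) ≤ 𝓝[Icc 0 1] 0 := nhdsWithin_mono _ Ioc_subset_Icc_self
  -- The comparison estimate is available for positive times only, so the limit is one-sided and its
  -- filter must be nontrivial.
  have : (𝓝[Ioc 0 1] (0 : ℝ)).NeBot := by
    rw [nhdsWithin_Ioc_eq_nhdsGT one_pos]
    infer_instance
  have h1 := (hc.2 0 (by simp)).mono_left hsub
  have h2 : Tendsto (fun t : ℝ => ENNReal.ofReal (2 * t * (energy H u₀).toReal) ^ (1 / 2 : ℝ))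
      (𝓝[Ioc 0 1] 0) (𝓝 0) := by
    have h3 : Tendsto (fun t : ℝ => 2 * t * (energy H u₀).toReal) (𝓝 0) (𝓝 0) := by
      have h4 : Continuous fun t : ℝ => 2 * t * (energy H u₀).toReal := by fun_prop
      simpa using h4.tendsto 0
    have h5 := ((ENNReal.tendsto_ofReal h3).mono_left
      (nhdsWithin_le_nhds (s := Ioc 0 1))).ennrpow_const (1 / 2 : ℝ)
    rwa [ENNReal.ofReal_zero, ENNReal.zero_rpow_of_pos (by norm_num)] at h5
  have h6 := h1.add h2
  rw [add_zero] at h6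
  have h7 : eLpNorm (u 0 - u₀) 2 (volume.restrict Ω) ≤ 0 := by
    refine ge_of_tendsto h6 ?_
    filter_upwards [self_mem_nhdsWithin] with t ht
    have hmt : MemLp (u t) 2 (volume.restrict Ω) := hc.1 t (Ioc_subset_Icc_self ht)
    have h8 : u 0 - u₀ = (u t - u₀) - (u t - u 0) := by
      funext x
      simp
    have h9 := hu.eLpNorm_sub_sq_le hΩ hp hu₀ ht.1
    have h10 := ENNReal.rpow_le_rpow h9 (by norm_num : (0 : ℝ) ≤ 1 / 2)
    rw [← ENNReal.rpow_mul, mul_one_div_cancel two_ne_zero, ENNReal.rpow_one,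
      show ENNReal.ofReal 2 = 2 by simp] at h10
    rw [h8, add_comm]
    exact (eLpNorm_sub_le (hmt.1.sub hu₀.memL2.1) (hmt.1.sub hm0.1) one_le_two).trans
      (add_le_add_left h10 _)
  have h11 := (eLpNorm_eq_zero_iff (hm0.1.sub hu₀.memL2.1) two_ne_zero).1 (le_antisymm h7 bot_le)
  filter_upwards [h11] with x hx
  simpa [sub_eq_zero] using hx

end IsVariationalSolution

/-! ### The perturbed variational inequality -/

/-- A test function of time: `η ∈ C_0^∞(0,T)`. -/
structure IsTimeTest (T : ℝ) (η : ℝ → ℝ) : Prop where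
  contDiff : ContDiff ℝ ∞ η
  hasCompactSupport : HasCompactSupport η
  tsupport_subset : tsupport η ⊆ Ioo 0 T

namespace IsTimeTest

variable {T : ℝ} {η : ℝ → ℝ}

lemma eq_zero (hη : IsTimeTest T η) {t : ℝ} (ht : t ∉ Ioo 0 T) : η t = 0 := by
  by_contra h0
  exact ht (hη.tsupport_subset (subset_tsupport _ h0))

lemma contDiff_one (hη : IsTimeTest T η) : ContDiff ℝ 1 η :=
  hη.contDiff.of_le (by exact_mod_cast le_top)

lemma continuous_deriv (hη : IsTimeTest T η) : Continuous (deriv η) :=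
  hη.contDiff_one.continuous_deriv le_rfl

lemma exists_bound (hη : IsTimeTest T η) : ∃ M, 0 ≤ M ∧ (∀ t, |η t| ≤ M) ∧ ∀ t, |deriv η t| ≤ M := by
  obtain ⟨M, hM⟩ := hη.hasCompactSupport.exists_bound_of_continuous hη.contDiff.continuous
  obtain ⟨M', hM'⟩ := (hη.hasCompactSupport.deriv).exists_bound_of_continuous hη.continuous_deriv
  exact ⟨max M M', (norm_nonneg _).trans ((hM 0).trans (le_max_left _ _)),
    fun t => (hM t).trans (le_max_left _ _), fun t => (hM' t).trans (le_max_right _ _)⟩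

lemma integral_mul_deriv_eq_zero (hη : IsTimeTest T η) (hT : 0 ≤ T) :
    ∫ t in Ioo 0 T, η t * deriv η t = 0 := by
  have h1 := intervalIntegral.integral_mul_deriv_eq_deriv_mul (a := 0) (b := T)
    (u := η) (v := η) (u' := deriv η) (v' := deriv η)
    (fun t _ => (hη.contDiff_one.differentiable one_ne_zero t).hasDerivAt)
    (fun t _ => (hη.contDiff_one.differentiable one_ne_zero t).hasDerivAt)
    (hη.continuous_deriv.intervalIntegrable _ _) (hη.continuous_deriv.intervalIntegrable _ _)
  rw [hη.eq_zero (t := 0) (by simp), hη.eq_zero (t := T) (by simp),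
    intervalIntegral.integral_of_le hT, intervalIntegral.integral_of_le hT,
    integral_Ioc_eq_integral_Ioo, integral_Ioc_eq_integral_Ioo] at h1
  have h2 : ∫ t in Ioo 0 T, deriv η t * η t = ∫ t in Ioo 0 T, η t * deriv η t := by
    simp only [mul_comm]
  linarith

end IsTimeTest

lemma timeAvg_add_mul {h T ε : ℝ} (hh : h ≠ 0) {u₀ w : Sp N → ℝ} {u : ℝ → Sp N → ℝ} {η : ℝ → ℝ}
    (hη : IsTimeTest T η) {x : Sp N} (hi : IntegrableOn (fun t => u t x) (Ioo 0 T)) {t : ℝ}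
    (ht : t ∈ Icc 0 T) :
    timeAvg h u₀ (fun t x => u t x + ε * (η t + h * deriv η t) * w x) t x
      = timeAvg h u₀ u t x + ε * η t * w x := by
  have hc : Continuous fun t => η t + h * deriv η t := by
    have := hη.contDiff.continuous
    have := hη.continuous_deriv
    fun_prop
  have hi2 : IntegrableOn (fun t => ε * w x * (η t + h * deriv η t)) (Ioo 0 T) :=
    ((hc.integrableOn_Icc).mono_set Ioo_subset_Icc_self).const_mul _
  have h1 := expAvg_add (h := h) hi hi2 (u₀ x) 0 ht
  have h2 := expAvg_const_mul h 0 (ε * w x) (fun t => η t + h * deriv η t) t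
  rw [expAvg_add_mul_deriv hh hη.contDiff_one (hη.eq_zero (by simp)), mul_zero] at h2
  rw [h2, add_zero] at h1
  have h3 : ∀ s, u s x + ε * (η s + h * deriv η s) * w x
      = u s x + ε * w x * (η s + h * deriv η s) := fun s => by ring
  simp only [timeAvg, h3, h1]
  ring

lemma integral_linear_combination {Y : Type*} [MeasurableSpace Y] {ν : Measure Y}
    {f₁ f₂ f₃ f₄ f₅ : Y → ℝ} (h₁ : Integrable f₁ ν) (h₂ : Integrable f₂ ν) (h₃ : Integrable f₃ ν)
    (h₄ : Integrable f₄ ν) (h₅ : Integrable f₅ ν) (a b : ℝ) :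
    ∫ y, (f₁ y + a * f₂ y + a * f₃ y - a * f₄ y + b * f₅ y) ∂ν
      = ∫ y, f₁ y ∂ν + a * ∫ y, f₂ y ∂ν + a * ∫ y, f₃ y ∂ν - a * ∫ y, f₄ y ∂ν
        + b * ∫ y, f₅ y ∂ν := by
  have j₂ : Integrable (fun y => f₁ y + a * f₂ y) ν := h₁.add (h₂.const_mul a)
  have j₃ : Integrable (fun y => f₁ y + a * f₂ y + a * f₃ y) ν := j₂.add (h₃.const_mul a)
  have j₄ : Integrable (fun y => f₁ y + a * f₂ y + a * f₃ y - a * f₄ y) ν :=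
    j₃.sub (h₄.const_mul a)
  rw [integral_add j₄ (h₅.const_mul b), integral_sub j₃ (h₄.const_mul a),
    integral_add j₂ (h₃.const_mul a), integral_add h₁ (h₂.const_mul a)]
  simp only [integral_const_mul]

/-! ### The time-derivative term for an averaged perturbation. -/

section Slope

variable {Ω : Set (Sp N)} {T h ε : ℝ} {u₀ w : Sp N → ℝ}
  {u : ℝ → Sp N → ℝ} {η : ℝ → ℝ}

/-- With a = [u]_h the two factors are (u - a)/h + εη'w and a - u + εηw. The product of the first
terms is nonpositive; ε(u - a)ηw/h and εaη'w cancel after integration by parts; ε²ηη'w² has integral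
zero. What remains is -ε ∫∫ u η' w. -/
lemma integral_deriv_timeAvg_mul_sub_le (hT : 0 < T) (hh : 0 < h)
    (hu₀ : MemLp u₀ 2 (volume.restrict Ω)) (hw : MemLp w 2 (volume.restrict Ω))
    (hu : MemLp (fun q : ℝ × Sp N => u q.1 q.2) 2 (cylinder Ω T)) (hη : IsTimeTest T η) :
    ∫ q, ((u q.1 q.2 + ε * (η q.1 + h * deriv η q.1) * w q.2)
        - timeAvg h u₀ (fun t x => u t x + ε * (η t + h * deriv η t) * w x) q.1 q.2) / h
        * (timeAvg h u₀ (fun t x => u t x + ε * (η t + h * deriv η t) * w x) q.1 q.2 - u q.1 q.2)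
        ∂(cylinder Ω T)
      ≤ - ε * ∫ q, u q.1 q.2 * (deriv η q.1 * w q.2) ∂(cylinder Ω T) := by
  obtain ⟨M, -, hM, hM'⟩ := hη.exists_bound
  have hηc := hη.contDiff.continuous
  have hηc' := hη.continuous_deriv
  have htwo : ENNReal.ofReal 2 = 2 := by simp
  have hi : ∀ᵐ x ∂(volume.restrict Ω), IntegrableOn (fun t => u t x) (Ioo 0 T) :=
    ae_integrableOn_section one_le_two (by simp) hu
  set a : ℝ → Sp N → ℝ := timeAvg h u₀ u with ha
  have ha2 : MemLp (fun q : ℝ × Sp N => a q.1 q.2) 2 (cylinder Ω T) := by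
    have := memLp_expAvg (μ := volume.restrict Ω) (p := 2) (f := u) (f₀ := u₀) hh hT one_le_two
      (by rwa [htwo]) (by rw [htwo]; exact hu)
    rwa [htwo] at this
  have hd2 : MemLp (fun q : ℝ × Sp N => (u q.1 q.2 - a q.1 q.2) / h) 2 (cylinder Ω T) := by
    simp only [div_eq_inv_mul]
    exact (hu.sub ha2).const_mul h⁻¹
  have hηw : MemLp (fun q : ℝ × Sp N => η q.1 * w q.2) 2 (cylinder Ω T) :=
    memLp_mul_prod hηc.measurable hM hw
  have hηw' : MemLp (fun q : ℝ × Sp N => deriv η q.1 * w q.2) 2 (cylinder Ω T) :=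
    memLp_mul_prod hηc'.measurable hM' hw
  have i1 : Integrable (fun q : ℝ × Sp N => (u q.1 q.2 - a q.1 q.2) / h * (η q.1 * w q.2))
      (cylinder Ω T) := hd2.integrable_mul hηw
  have i2 : Integrable (fun q : ℝ × Sp N => a q.1 q.2 * (deriv η q.1 * w q.2))
      (cylinder Ω T) := ha2.integrable_mul hηw'
  have i3 : Integrable (fun q : ℝ × Sp N => u q.1 q.2 * (deriv η q.1 * w q.2))
      (cylinder Ω T) := hu.integrable_mul hηw'
  have i4 : Integrable (fun q : ℝ × Sp N => (η q.1 * w q.2) * (deriv η q.1 * w q.2))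
      (cylinder Ω T) := hηw.integrable_mul hηw'
  have i5 : Integrable (fun q : ℝ × Sp N => (u q.1 q.2 - a q.1 q.2) / h * (a q.1 q.2 - u q.1 q.2))
      (cylinder Ω T) := hd2.integrable_mul (ha2.sub hu)
  have e1 : ∫ q, a q.1 q.2 * (deriv η q.1 * w q.2) ∂(cylinder Ω T)
      = - ∫ q, (u q.1 q.2 - a q.1 q.2) / h * (η q.1 * w q.2) ∂(cylinder Ω T) := by
    have hder : ∀ q : ℝ × Sp N, deriv (fun t => η t * w q.2) q.1 = deriv η q.1 * w q.2 :=
      fun q => deriv_mul_const (hη.contDiff_one.differentiable one_ne_zero q.1) _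
    have := integral_expAvg_mul_deriv_prod (μ := volume.restrict Ω) (h := h) (f₀ := u₀) (f := u)
      (ψ := fun t x => η t * w x) hT hi (fun x => hη.contDiff_one.mul contDiff_const)
      (fun x => by simp [hη.eq_zero (t := 0)]) (fun x => by simp [hη.eq_zero (t := T)])
      (by simp only [hder]; exact i2) i1
    simp only [hder] at this
    exact this
  have e2 : ∫ q, (η q.1 * w q.2) * (deriv η q.1 * w q.2) ∂(cylinder Ω T) = 0 := by
    have h1 : ∀ q : ℝ × Sp N, (η q.1 * w q.2) * (deriv η q.1 * w q.2)
        = (η q.1 * deriv η q.1) * (w q.2 * w q.2) := fun q => by ring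
    simp only [h1, cylinder]
    rw [integral_prod_mul (fun t => η t * deriv η t) (fun x => w x * w x),
      hη.integral_mul_deriv_eq_zero hT.le, zero_mul]
  have e3 : ∫ q, (u q.1 q.2 - a q.1 q.2) / h * (a q.1 q.2 - u q.1 q.2) ∂(cylinder Ω T) ≤ 0 := by
    refine integral_nonpos fun q => ?_
    simp only [Pi.zero_apply]
    rw [div_mul_eq_mul_div, div_le_iff₀ hh]
    nlinarith [sq_nonneg (u q.1 q.2 - a q.1 q.2)]
  have key : ∫ q, ((u q.1 q.2 + ε * (η q.1 + h * deriv η q.1) * w q.2)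
        - timeAvg h u₀ (fun t x => u t x + ε * (η t + h * deriv η t) * w x) q.1 q.2) / h
        * (timeAvg h u₀ (fun t x => u t x + ε * (η t + h * deriv η t) * w x) q.1 q.2 - u q.1 q.2)
        ∂(cylinder Ω T)
      = ∫ q, ((u q.1 q.2 - a q.1 q.2) / h * (a q.1 q.2 - u q.1 q.2)
          + ε * ((u q.1 q.2 - a q.1 q.2) / h * (η q.1 * w q.2))
          + ε * (a q.1 q.2 * (deriv η q.1 * w q.2))
          - ε * (u q.1 q.2 * (deriv η q.1 * w q.2))
          + ε ^ 2 * ((η q.1 * w q.2) * (deriv η q.1 * w q.2))) ∂(cylinder Ω T) := by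
    refine integral_congr_ae ?_
    filter_upwards [ae_cylinder_mem_Ioo Ω T, ae_prod_of_ae_snd (ν := volume.restrict (Ioo 0 T)) hi]
      with q hq1 hq2
    rw [timeAvg_add_mul hh.ne' hη hq2 (Ioo_subset_Icc_self hq1), ← ha]
    field_simp
    ring
  rw [key, integral_linear_combination i5 i1 i2 i3 i4, e1, e2]
  linarith

end Slope

/-! ### The inequality for perturbed averages. -/

section Main

variable {Ω : Set (Sp N)} [IsFiniteMeasure (volume.restrict Ω)] {s p c : ℝ}
  {H : Sp N → Sp N → ℝ → ℝ} {u₀ : Sp N → ℝ} {u : ℝ → Sp N → ℝ} {K : Sp N × Sp N → ℝ → ℝ}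

lemma IsGrowthDensity.integrable_comp (hK : IsGrowthDensity p c K) (hp : 0 < p) {T : ℝ}
    {f : ℝ × (Sp N × Sp N) → ℝ}
    (hf : MemLp f (ENNReal.ofReal p) ((volume.restrict (Ioo 0 T)).prod volume)) :
    Integrable (fun q : ℝ × (Sp N × Sp N) => K q.2 (f q))
      ((volume.restrict (Ioo 0 T)).prod volume) := by
  have h1 := hf.integrable_norm_rpow (by simpa using hp) ENNReal.ofReal_ne_top
  rw [ENNReal.toReal_ofReal hp.le] at h1
  refine (h1.const_mul c).mono' (hK.aestronglyMeasurable_comp hf.1) (ae_of_all _ fun q => ?_)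
  rw [Real.norm_of_nonneg (hK.nonneg _ _), Real.norm_eq_abs]
  exact hK.le _ _

lemma lintegral_energy_eq_ofReal (hK : IsGrowthDensity p c K) (hp : 1 < p)
    (hKH : ∀ᵐ z : Sp N × Sp N, ∀ w : Sp N → ℝ,
      H z.1 z.2 (w z.1 - w z.2) / ‖z.1 - z.2‖ ^ N = K z (diffQuot s p w z)) {T : ℝ}
    {u : ℝ → Sp N → ℝ} (hu : MemLpW s p T u) :
    ∫⁻ t in Ioo 0 T, energy H (u t)
      = ENNReal.ofReal (∫ q : ℝ × (Sp N × Sp N), K q.2 (diffQuot s p (u q.1) q.2)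
        ∂((volume.restrict (Ioo 0 T)).prod volume)) := by
  rw [lintegral_energy_eq hK hKH hu.1, ofReal_integral_eq_lintegral_ofReal
    (hK.integrable_comp (by linarith) ((memLpW_iff hp).1 hu).2)
    (ae_of_all _ fun q => hK.nonneg _ _)]

/-- The comparison function is the average of U. Jensen's inequality replaces its energy by that of
U, the initial square vanishes since averages start at u₀, and the terminal square is dropped. No
average of u is left, so h and ε may be tied together freely. -/
lemma IsVariationalSolution.perturbed_inequality (hu : IsVariationalSolution Ω s p H u₀ u)
    (hΩ : MeasurableSet Ω) (hp : 1 < p) (hu₀ : IsData Ω s p H u₀) (hK : IsGrowthDensity p c K)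
    (hKH : ∀ᵐ z : Sp N × Sp N, ∀ w : Sp N → ℝ,
      H z.1 z.2 (w z.1 - w z.2) / ‖z.1 - z.2‖ ^ N = K z (diffQuot s p w z)) {T h ε : ℝ}
    (hT : 0 < T) (hh : 0 < h) {w : Sp N → ℝ} (hw : MemW s p w) (hw0 : ∀ᵐ x, x ∉ Ω → w x = 0)
    (hw2 : MemLp w 2 (volume.restrict Ω)) {η : ℝ → ℝ} (hη : IsTimeTest T η) :
    ∫ q : ℝ × (Sp N × Sp N), K q.2 (diffQuot s p (u q.1) q.2)
        ∂((volume.restrict (Ioo 0 T)).prod volume)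
      ≤ h * (energy H u₀).toReal
        + ∫ q : ℝ × (Sp N × Sp N), K q.2 (diffQuot s p (u q.1) q.2
            + ε * (η q.1 + h * deriv η q.1) * diffQuot s p w q.2)
          ∂((volume.restrict (Ioo 0 T)).prod volume)
        - ε * ∫ q, u q.1 q.2 * (deriv η q.1 * w q.2) ∂(cylinder Ω T) := by
  obtain ⟨M, hM0, hM, hM'⟩ := hη.exists_bound
  have hζc : Continuous fun t => ε * (η t + h * deriv η t) := by
    have := hη.contDiff.continuous
    have := hη.continuous_deriv
    fun_prop
  have hζ : ∀ t, |ε * (η t + h * deriv η t)| ≤ |ε| * (M + h * M) := fun t => by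
    rw [abs_mul]
    refine mul_le_mul_of_nonneg_left ((abs_add_le _ _).trans (add_le_add (hM t) ?_)) (abs_nonneg _)
    rw [abs_mul, abs_of_pos hh]
    exact mul_le_mul_of_nonneg_left (hM' t) hh.le
  set U : ℝ → Sp N → ℝ := fun t x => u t x + ε * (η t + h * deriv η t) * w x with hU
  have huT := hu.memLpW T hT
  have hu2 := hu.memLp_two_cylinder hΩ hp hu₀ hT
  have hUW : MemLpW s p T U := huT.add hp (memLpW_mul hp hζc.measurable hζ hw)
  have hU2 : MemLp (fun q : ℝ × Sp N => U q.1 q.2) 2 (cylinder Ω T) :=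
    hu2.add (memLp_mul_prod hζc.measurable hζ hw2)
  have hUb : ∀ᵐ t ∂(volume.restrict (Ioo 0 T)), ∀ᵐ x, x ∉ Ω → U t x - u₀ x = 0 := by
    filter_upwards [(hu.boundary T hT).2] with t ht
    filter_upwards [ht, hw0] with x hx hx0 hxΩ
    have := hx hxΩ
    simp only [Pi.sub_apply] at this
    simp [hU, hx0 hxΩ, this]
  have h1 := hu.inequality T hT _ _
    (isComparison_timeAvg hp hT hh hu₀.memW hu₀.memL2 hUW hU2 hUb hΩ)
  have hE := lintegral_energy_timeAvg_le hp hK hKH hT hh hu₀.memW hUW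
  have hfin : ENNReal.ofReal h * energy H u₀ + ∫⁻ t in Ioo 0 T, energy H (U t) ≠ ⊤ := by
    refine (ENNReal.add_lt_top.2 ⟨ENNReal.mul_lt_top ENNReal.ofReal_lt_top hu₀.energy_lt_top, ?_⟩).ne
    rw [lintegral_energy_eq_ofReal hK hp hKH hUW]
    exact ENNReal.ofReal_lt_top
  have h2 := h1.trans (add_le_add_left (EReal.coe_ennreal_le_coe_ennreal_iff.2 hE) _)
  obtain ⟨-, h3⟩ := toReal_le_of_coe_le_coe_add hfin h2
  rw [ENNReal.toReal_add (ENNReal.mul_lt_top ENNReal.ofReal_lt_top hu₀.energy_lt_top).ne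
    (by rw [lintegral_energy_eq_ofReal hK hp hKH hUW]; exact ENNReal.ofReal_ne_top),
    ENNReal.toReal_mul, ENNReal.toReal_ofReal hh.le,
    lintegral_energy_eq_ofReal hK hp hKH hUW, lintegral_energy_eq_ofReal hK hp hKH huT,
    ENNReal.toReal_ofReal (integral_nonneg fun q => hK.nonneg _ _),
    ENNReal.toReal_ofReal (integral_nonneg fun q => hK.nonneg _ _)] at h3
  have h4 := integral_deriv_timeAvg_mul_sub_le (ε := ε) hT hh hu₀.memL2 hw2 hu2 hη
  have h5 : ∫ x in Ω, (timeAvg h u₀ U 0 x - u₀ x) ^ 2 = 0 := by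
    simp [timeAvg]
  have h6 : 0 ≤ ∫ x in Ω, (timeAvg h u₀ U T x - u T x) ^ 2 :=
    integral_nonneg fun x => sq_nonneg _
  have h7 : ∀ q : ℝ × (Sp N × Sp N), diffQuot s p (U q.1) q.2 = diffQuot s p (u q.1) q.2
      + ε * (η q.1 + h * deriv η q.1) * diffQuot s p w q.2 := fun q => by
    have h8 := congrFun (diffQuot_add s p (u q.1) ((ε * (η q.1 + h * deriv η q.1)) • w)) q.2
    rw [diffQuot_smul] at h8
    exact h8
  simp only [h7] at h3
  rw [h5] at h3
  linarith

end Main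

/-! ### The Euler-Lagrange identity for products of functions of time and space -/

/-- A common majorant `B` of argument and increment gives an integrable bound independent of ε. -/
lemma IsGrowthDensity.norm_deriv_mul_le {Z : Type*} [MeasurableSpace Z] {p c : ℝ} {K : Z → ℝ → ℝ}
    (hK : IsGrowthDensity p c K) (hp : 1 < p) (hc : 0 ≤ c) (z : Z) {ξ ζ B : ℝ} (hξ : |ξ| ≤ B)
    (hζ : |ζ| ≤ B) : ‖deriv (K z) ξ * ζ‖ ≤ c * 2 ^ p * B ^ p := by
  have hB : 0 ≤ B := (abs_nonneg _).trans hξ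
  have h1 : |deriv (K z) ξ| ≤ c * 2 ^ p * B ^ (p - 1) :=
    (hK.abs_deriv_le hp z ξ).trans (mul_le_mul_of_nonneg_left
      (Real.rpow_le_rpow (abs_nonneg _) hξ (by linarith)) (by positivity))
  have h2 : B ^ p = B ^ (p - 1) * B := by
    rw [← Real.rpow_add_one' hB (by linarith), sub_add_cancel]
  rw [norm_mul, Real.norm_eq_abs, Real.norm_eq_abs, h2, ← mul_assoc]
  exact mul_le_mul h1 hζ (abs_nonneg _) (by positivity)

lemma IsGrowthDensity.aestronglyMeasurable_deriv_comp {p c : ℝ} {K : Sp N × Sp N → ℝ → ℝ}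
    (hK : IsGrowthDensity p c K) {T : ℝ} {f : ℝ × (Sp N × Sp N) → ℝ}
    (hf : AEStronglyMeasurable f ((volume.restrict (Ioo 0 T)).prod volume)) :
    AEStronglyMeasurable (fun q : ℝ × (Sp N × Sp N) => deriv (K q.2) (f q))
      ((volume.restrict (Ioo 0 T)).prod volume) :=
  (hK.measurable_deriv.comp_aemeasurable
    (measurable_snd.aemeasurable.prodMk hf.aemeasurable)).aestronglyMeasurable

section EulerLagrange

variable {Ω : Set (Sp N)} [IsFiniteMeasure (volume.restrict Ω)] {s p c : ℝ}
  {H : Sp N → Sp N → ℝ → ℝ} {u₀ : Sp N → ℝ} {u : ℝ → Sp N → ℝ} {K : Sp N × Sp N → ℝ → ℝ}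

/-- The choice h = ε² leaves ε E(u₀) after division by ε. Convexity bounds the difference quotient
of the energy by the derivative at the perturbed point, and dominated convergence brings that point
back to u. -/
lemma IsVariationalSolution.integral_mul_deriv_le (hu : IsVariationalSolution Ω s p H u₀ u)
    (hΩ : MeasurableSet Ω) (hp : 1 < p) (hu₀ : IsData Ω s p H u₀) (hK : IsGrowthDensity p c K)
    (hc : 0 ≤ c) (hKH : ∀ᵐ z : Sp N × Sp N, ∀ w : Sp N → ℝ,
      H z.1 z.2 (w z.1 - w z.2) / ‖z.1 - z.2‖ ^ N = K z (diffQuot s p w z)) {T : ℝ}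
    (hT : 0 < T) {w : Sp N → ℝ} (hw : MemW s p w) (hw0 : ∀ᵐ x, x ∉ Ω → w x = 0)
    (hw2 : MemLp w 2 (volume.restrict Ω)) {η : ℝ → ℝ} (hη : IsTimeTest T η) :
    ∫ q, u q.1 q.2 * (deriv η q.1 * w q.2) ∂(cylinder Ω T)
      ≤ ∫ q : ℝ × (Sp N × Sp N), deriv (K q.2) (diffQuot s p (u q.1) q.2)
          * (η q.1 * diffQuot s p w q.2) ∂((volume.restrict (Ioo 0 T)).prod volume) := by
  obtain ⟨M, hM0, hM, hM'⟩ := hη.exists_bound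
  have hηc := hη.contDiff.continuous
  have hηc' := hη.continuous_deriv
  set ε : ℕ → ℝ := fun n => 1 / ((n : ℝ) + 1) with hε
  have hε0 : ∀ n, 0 < ε n := fun n => by positivity
  have hε1 : ∀ n, ε n ≤ 1 := fun n => by
    rw [hε, div_le_one (by positivity)]
    have : (0 : ℝ) ≤ n := n.cast_nonneg
    linarith
  have hεlim : Tendsto ε atTop (𝓝 0) := tendsto_one_div_add_atTop_nhds_zero_nat
  set f : ℝ × (Sp N × Sp N) → ℝ := fun q => diffQuot s p (u q.1) q.2 with hf
  set g : ℝ × (Sp N × Sp N) → ℝ := fun q => diffQuot s p w q.2 with hg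
  have hfp : MemLp f (ENNReal.ofReal p) ((volume.restrict (Ioo 0 T)).prod volume) :=
    ((memLpW_iff hp).1 (hu.memLpW T hT)).2
  have hgp : MemLp g (ENNReal.ofReal p) ((volume.restrict (Ioo 0 T)).prod volume) :=
    ((memW_iff s p w).1 hw).2.comp_snd _
  -- This is η + hη' at h = ε²; as ε ≤ 1, it is bounded by M + M.
  set ζ : ℕ → ℝ → ℝ := fun n t => η t + ε n ^ 2 * deriv η t with hζ
  have hζc : ∀ n, Continuous (ζ n) := fun n => by fun_prop
  have hζM : ∀ n t, |ζ n t| ≤ 2 * M := fun n t => by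
    refine (abs_add_le _ _).trans ?_
    have h1 : |ε n ^ 2 * deriv η t| ≤ 1 * M := by
      rw [abs_mul]
      refine mul_le_mul ?_ (hM' t) (abs_nonneg _) zero_le_one
      rw [abs_of_nonneg (by positivity)]
      exact pow_le_one₀ (hε0 n).le (hε1 n)
    linarith [hM t]
  -- Because ε ≤ 1, this majorizes both the perturbed argument f + εζg and the direction ζg.
  set B : ℝ × (Sp N × Sp N) → ℝ := fun q => |f q| + 2 * M * |g q| with hB
  have hBi : Integrable (fun q => c * 2 ^ p * B q ^ p)
      ((volume.restrict (Ioo 0 T)).prod volume) := by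
    have h1 : MemLp B (ENNReal.ofReal p) ((volume.restrict (Ioo 0 T)).prod volume) :=
      hfp.abs.add (hgp.abs.const_mul (2 * M))
    have h2 := h1.integrable_norm_rpow (by simp; linarith) ENNReal.ofReal_ne_top
    rw [ENNReal.toReal_ofReal (by linarith)] at h2
    refine (h2.const_mul (c * 2 ^ p)).congr (ae_of_all _ fun q => ?_)
    have hBq : 0 ≤ B q := by positivity
    simp only [Real.norm_of_nonneg hBq]
  have hbound1 : ∀ n q, |f q + ε n * ζ n q.1 * g q| ≤ B q := fun n q => by
    refine (abs_add_le _ _).trans (add_le_add le_rfl ?_)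
    rw [abs_mul, abs_mul, abs_of_pos (hε0 n)]
    refine mul_le_mul_of_nonneg_right ?_ (abs_nonneg _)
    calc ε n * |ζ n q.1| ≤ 1 * (2 * M) :=
          mul_le_mul (hε1 n) (hζM n _) (abs_nonneg _) zero_le_one
      _ = 2 * M := one_mul _
  have hbound2 : ∀ n q, |ζ n q.1 * g q| ≤ B q := fun n q => by
    rw [abs_mul]
    refine le_trans (mul_le_mul_of_nonneg_right (hζM n _) (abs_nonneg _)) ?_
    exact le_add_of_nonneg_left (abs_nonneg _)
  have hmeas : ∀ n, AEStronglyMeasurable (fun q => f q + ε n * ζ n q.1 * g q)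
      ((volume.restrict (Ioo 0 T)).prod volume) := fun n =>
    hfp.1.add ((((hζc n).comp continuous_fst).aestronglyMeasurable.const_mul (ε n)).mul hgp.1)
  have hmeas2 : ∀ n, AEStronglyMeasurable
      (fun q => deriv (K q.2) (f q + ε n * ζ n q.1 * g q) * (ζ n q.1 * g q))
      ((volume.restrict (Ioo 0 T)).prod volume) := fun n =>
    (hK.aestronglyMeasurable_deriv_comp (hmeas n)).mul
      (((hζc n).comp continuous_fst).aestronglyMeasurable.mul hgp.1)
  have hbd : ∀ n q, ‖deriv (K q.2) (f q + ε n * ζ n q.1 * g q) * (ζ n q.1 * g q)‖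
      ≤ c * 2 ^ p * B q ^ p := fun n q =>
    hK.norm_deriv_mul_le hp hc q.2 (hbound1 n q) (hbound2 n q)
  have hlim : Tendsto (fun n => ∫ q, deriv (K q.2) (f q + ε n * ζ n q.1 * g q) * (ζ n q.1 * g q)
      ∂((volume.restrict (Ioo 0 T)).prod volume)) atTop
      (𝓝 (∫ q, deriv (K q.2) (f q) * (η q.1 * g q)
        ∂((volume.restrict (Ioo 0 T)).prod volume))) := by
    refine tendsto_integral_of_dominated_convergence _ hmeas2 hBi
      (fun n => ae_of_all _ (hbd n)) (ae_of_all _ fun q => ?_)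
    have h1 : Tendsto (fun n => ζ n q.1) atTop (𝓝 (η q.1)) := by
      have := ((hεlim.pow 2).mul_const (deriv η q.1)).const_add (η q.1)
      simpa using this
    have h2 : Tendsto (fun n => f q + ε n * ζ n q.1 * g q) atTop (𝓝 (f q)) := by
      have := ((hεlim.mul h1).mul_const (g q)).const_add (f q)
      simpa using this
    have h3 : Continuous (deriv (K q.2)) := (hK.contDiff q.2).continuous_deriv le_rfl
    exact ((h3.tendsto _).comp h2).mul (h1.mul_const _)
  have hle : ∀ n, ∫ q, u q.1 q.2 * (deriv η q.1 * w q.2) ∂(cylinder Ω T)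
      ≤ ε n * (energy H u₀).toReal
        + ∫ q, deriv (K q.2) (f q + ε n * ζ n q.1 * g q) * (ζ n q.1 * g q)
          ∂((volume.restrict (Ioo 0 T)).prod volume) := by
    intro n
    have h1 := hu.perturbed_inequality hΩ hp hu₀ hK hKH hT (pow_pos (hε0 n) 2) (ε := ε n) hw hw0 hw2
      hη
    have hp0 : 0 < p := by linarith
    have hi1 := hK.integrable_comp hp0 hfp
    have hi2 : Integrable (fun q : ℝ × (Sp N × Sp N) => K q.2 (f q + ε n * ζ n q.1 * g q))
        ((volume.restrict (Ioo 0 T)).prod volume) := by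
      refine hK.integrable_comp hp0 (hfp.add ?_)
      exact memLp_mul_prod (ζ := fun t => ε n * ζ n t) (M := |ε n| * (2 * M))
        ((hζc n).measurable.const_mul _) (fun t => by
          rw [abs_mul]
          exact mul_le_mul_of_nonneg_left (hζM n t) (abs_nonneg _)) ((memW_iff s p w).1 hw).2
    have h2 : ∫ q, K q.2 (f q + ε n * ζ n q.1 * g q) ∂((volume.restrict (Ioo 0 T)).prod volume)
        - ∫ q, K q.2 (f q) ∂((volume.restrict (Ioo 0 T)).prod volume)
        ≤ ε n * ∫ q, deriv (K q.2) (f q + ε n * ζ n q.1 * g q) * (ζ n q.1 * g q)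
          ∂((volume.restrict (Ioo 0 T)).prod volume) := by
      rw [← integral_sub hi2 hi1, ← integral_const_mul]
      refine integral_mono (hi2.sub hi1)
        ((hBi.mono' (hmeas2 n) (ae_of_all _ (hbd n))).const_mul (ε n)) fun q => ?_
      -- The tangent line is taken at the perturbed point and evaluated at f, which bounds K(f +
      -- εζg) - K(f) from above.
      have h3 := hK.add_deriv_mul_le q.2 (f q + ε n * ζ n q.1 * g q) (f q)
      simp only
      linarith
    have h4 : ε n * ∫ q, u q.1 q.2 * (deriv η q.1 * w q.2) ∂(cylinder Ω T)
        ≤ ε n * (ε n * (energy H u₀).toReal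
          + ∫ q, deriv (K q.2) (f q + ε n * ζ n q.1 * g q) * (ζ n q.1 * g q)
            ∂((volume.restrict (Ioo 0 T)).prod volume)) := by
      rw [mul_add, ← mul_assoc, ← pow_two]
      linarith
    exact le_of_mul_le_mul_left h4 (hε0 n)
  have h5 := (hεlim.mul_const (energy H u₀).toReal).add hlim
  rw [zero_mul, zero_add] at h5
  exact ge_of_tendsto' h5 hle

/-- Both sides are linear in η, so the inequality for -η is the reverse one. -/
lemma IsVariationalSolution.integral_mul_deriv_eq (hu : IsVariationalSolution Ω s p H u₀ u)
    (hΩ : MeasurableSet Ω) (hp : 1 < p) (hu₀ : IsData Ω s p H u₀) (hK : IsGrowthDensity p c K)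
    (hc : 0 ≤ c) (hKH : ∀ᵐ z : Sp N × Sp N, ∀ w : Sp N → ℝ,
      H z.1 z.2 (w z.1 - w z.2) / ‖z.1 - z.2‖ ^ N = K z (diffQuot s p w z)) {T : ℝ}
    (hT : 0 < T) {w : Sp N → ℝ} (hw : MemW s p w) (hw0 : ∀ᵐ x, x ∉ Ω → w x = 0)
    (hw2 : MemLp w 2 (volume.restrict Ω)) {η : ℝ → ℝ} (hη : IsTimeTest T η) :
    ∫ q, u q.1 q.2 * (deriv η q.1 * w q.2) ∂(cylinder Ω T)
      = ∫ q : ℝ × (Sp N × Sp N), deriv (K q.2) (diffQuot s p (u q.1) q.2)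
          * (η q.1 * diffQuot s p w q.2) ∂((volume.restrict (Ioo 0 T)).prod volume) := by
  refine le_antisymm (hu.integral_mul_deriv_le hΩ hp hu₀ hK hc hKH hT hw hw0 hw2 hη) ?_
  have hη' : IsTimeTest T (fun t => -η t) :=
    ⟨hη.contDiff.neg, hη.hasCompactSupport.neg, by
      have : tsupport (fun t => -η t) = tsupport η := by
        simp [tsupport, Function.support_fun_neg]
      rw [this]
      exact hη.tsupport_subset⟩
  have h1 := hu.integral_mul_deriv_le hΩ hp hu₀ hK hc hKH hT hw hw0 hw2 hη'
  simp only [deriv.fun_neg, neg_mul, mul_neg, integral_neg] at h1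
  linarith

end EulerLagrange

/-! ### Measurability of curves in `L^r` -/

lemma measurable_of_measurable_edist {α E : Type*} [MeasurableSpace α] [PseudoEMetricSpace E]
    [SecondCountableTopology E] [MeasurableSpace E] [BorelSpace E] {f : α → E}
    (hf : ∀ c, Measurable fun a => edist (f a) c) : Measurable f := by
  have hb : TopologicalSpace.IsTopologicalBasis
      {U : Set E | ∃ c : E, ∃ r : ℝ≥0∞, U = Metric.eball c r} := by
    refine TopologicalSpace.isTopologicalBasis_of_isOpen_of_nhds ?_ ?_
    · rintro U ⟨c, r, rfl⟩
      exact Metric.isOpen_eball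
    · intro a U ha hU
      obtain ⟨r, hr, hrU⟩ := EMetric.isOpen_iff.1 hU a ha
      exact ⟨Metric.eball a r, ⟨a, r, rfl⟩, Metric.mem_eball_self hr, hrU⟩
  rw [BorelSpace.measurable_eq (α := E), hb.borel_eq_generateFrom]
  refine measurable_generateFrom ?_
  rintro U ⟨c, r, rfl⟩
  exact measurableSet_lt (hf c) measurable_const

/-- In the separable space L^r balls generate the Borel sets, so it suffices that the distance to
each fixed element be measurable in t. That distance is a power of a parameter integral of a jointly
measurable function. -/
lemma aestronglyMeasurable_curve_Lp {α X : Type*} [MeasurableSpace α] [MeasurableSpace X]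
    [MeasurableSpace.CountablyGenerated X] {ν : Measure α} {μ : Measure X} [SigmaFinite μ]
    {r : ℝ} [Fact (1 ≤ ENNReal.ofReal r)] (hr : 0 < r) {G : α × X → ℝ}
    (hG : StronglyMeasurable G) {F : α → Lp ℝ (ENNReal.ofReal r) μ}
    (hF : ∀ᵐ t ∂ν, F t =ᵐ[μ] fun x => G (t, x)) : AEStronglyMeasurable F ν := by
  let : MeasurableSpace (Lp ℝ (ENNReal.ofReal r) μ) := borel _
  have : BorelSpace (Lp ℝ (ENNReal.ofReal r) μ) := ⟨rfl⟩
  have : Fact (ENNReal.ofReal r ≠ ⊤) := ⟨ENNReal.ofReal_ne_top⟩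
  obtain ⟨B, hBsub, hBm, hB0⟩ := exists_measurable_superset_of_null hF
  classical
  set F' : α → Lp ℝ (ENNReal.ofReal r) μ := fun t => if t ∈ B then 0 else F t with hF'
  have h1 : Measurable F' := by
    refine measurable_of_measurable_edist fun c => ?_
    have h2 : (fun t => edist (F' t) c) = fun t => if t ∈ B then edist 0 c else
        (∫⁻ x, ‖G (t, x) - c x‖ₑ ^ r ∂μ) ^ r⁻¹ := by
      funext t
      by_cases ht : t ∈ B
      · simp [hF', ht]
      · have h3 : F t =ᵐ[μ] fun x => G (t, x) := by
          by_contra h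
          exact ht (hBsub h)
        simp only [hF', ht, if_false]
        have h4 : (⇑(F t) - ⇑c) =ᵐ[μ] fun x => G (t, x) - c x := by
          filter_upwards [h3] with x hx
          simp [hx]
        rw [Lp.edist_def, eLpNorm_congr_ae h4, ← eLpNorm_ofReal_rpow hr, ← ENNReal.rpow_mul,
          mul_inv_cancel₀ hr.ne', ENNReal.rpow_one]
    rw [h2]
    refine Measurable.ite hBm measurable_const (Measurable.pow_const ?_ _)
    have h5 : StronglyMeasurable fun q : α × X => G q - c q.2 :=
      hG.sub ((Lp.stronglyMeasurable c).comp_measurable measurable_snd)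
    exact (h5.enorm.pow_const r).lintegral_prod_right'
  refine ⟨F', h1.stronglyMeasurable, ?_⟩
  have h6 : ∀ᵐ t ∂ν, t ∉ B := by
    rw [ae_iff]
    simpa using hB0
  filter_upwards [h6] with t ht
  simp [hF', ht]

/-! ### The flux as an element of the dual space -/

lemma W0.memLp_diffQuot {Ω : Set (Sp N)} {s p : ℝ} (w : W0 Ω s p) :
    MemLp (diffQuot s p (w : Sp N → ℝ)) (ENNReal.ofReal p) volume :=
  ((memW_iff s p _).1 (Subtype.property w).1).2

section Dual

variable (Ω : Set (Sp N)) (s p : ℝ) [hp : Fact (1 < p)]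

instance : Fact (1 ≤ ENNReal.ofReal p) := ⟨by simpa using hp.out.le⟩

lemma holderConjugate_div_sub_one {p : ℝ} (hp : 1 < p) : (p / (p - 1)).HolderConjugate p :=
  (Real.HolderConjugate.conjExponent hp).symm

instance : Fact (1 ≤ ENNReal.ofReal (p / (p - 1))) :=
  ⟨by simpa using (holderConjugate_div_sub_one hp.out).lt.le⟩

instance : ENNReal.HolderConjugate (ENNReal.ofReal (p / (p - 1))) (ENNReal.ofReal p) :=
  (holderConjugate_div_sub_one hp.out).ennrealOfReal

/-- The weighted difference as a continuous linear map from `W^{s,p}_0(Ω)` to `L^p(ℝ^N × ℝ^N)`. -/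
def diffQuotL : W0 Ω s p →L[ℝ] Lp ℝ (ENNReal.ofReal p) (volume : Measure (Sp N × Sp N)) :=
  LinearMap.mkContinuous
    { toFun := fun w => (W0.memLp_diffQuot w).toLp _
      map_add' := fun v w => by
        rw [← MemLp.toLp_add]
        exact MemLp.toLp_congr _ _ (.of_eq (diffQuot_add s p _ _))
      map_smul' := fun c w => by
        rw [RingHom.id_apply, ← MemLp.toLp_const_smul]
        exact MemLp.toLp_congr _ _ (.of_eq (diffQuot_smul s p c _)) } 1 fun w => by
    rw [one_mul]
    change ‖(W0.memLp_diffQuot w).toLp _‖ ≤ (sobolevENorm s p (w : Sp N → ℝ)).toReal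
    rw [Lp.norm_toLp]
    exact ENNReal.toReal_mono (Subtype.property w).1.2.ne le_add_self

lemma coeFn_diffQuotL (w : W0 Ω s p) :
    diffQuotL Ω s p w =ᵐ[volume] diffQuot s p (w : Sp N → ℝ) :=
  (W0.memLp_diffQuot w).coeFn_toLp

/-- The map that takes `h ∈ L^{p'}` to the functional `w ↦ - ∫ h (w x - w y) / |x-y|^{N/p+s}`. -/
def fluxL : Lp ℝ (ENNReal.ofReal (p / (p - 1))) (volume : Measure (Sp N × Sp N)) →L[ℝ]
    StrongDual ℝ (W0 Ω s p) :=
  -- Transpose of the weighted difference applied to the pairing of L^{p'} with L^p. The sign is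
  -- that of ∂_t u in the equation.
  -((ContinuousLinearMap.compL ℝ (W0 Ω s p)
      (Lp ℝ (ENNReal.ofReal p) (volume : Measure (Sp N × Sp N))) ℝ).flip (diffQuotL Ω s p)).comp
    ((ContinuousLinearMap.mul ℝ ℝ).lpPairing volume (ENNReal.ofReal (p / (p - 1)))
      (ENNReal.ofReal p))

lemma fluxL_apply (h : Lp ℝ (ENNReal.ofReal (p / (p - 1))) (volume : Measure (Sp N × Sp N)))
    (w : W0 Ω s p) :
    fluxL Ω s p h w = - ∫ z, h z * diffQuot s p (w : Sp N → ℝ) z := by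
  have h1 : fluxL Ω s p h w = -((ContinuousLinearMap.mul ℝ ℝ).lpPairing volume
    (ENNReal.ofReal (p / (p - 1))) (ENNReal.ofReal p) h (diffQuotL Ω s p w)) := rfl
  rw [h1, ContinuousLinearMap.lpPairing_eq_integral]
  congr 1
  refine integral_congr_ae ?_
  filter_upwards [coeFn_diffQuotL Ω s p w] with z hz
  rw [hz]
  rfl

end Dual

/-! ### The nonlinear flux as a curve in L^{p'}. -/

section Flux

variable {s p c : ℝ} {K : Sp N × Sp N → ℝ → ℝ}

open Classical in
/-- The flux `z ↦ ∂_ξ K (z, f z)` as an element of `L^{p'}`, if it belongs to this space. -/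
def fluxLp (p : ℝ) (K : Sp N × Sp N → ℝ → ℝ) (f : Sp N × Sp N → ℝ) :
    Lp ℝ (ENNReal.ofReal (p / (p - 1))) (volume : Measure (Sp N × Sp N)) :=
  -- For the flux of `u` the default value 0 is taken on a null set of times at most.
  if h : MemLp (fun z => deriv (K z) (f z)) (ENNReal.ofReal (p / (p - 1))) volume then h.toLp _
  else 0

lemma coeFn_fluxLp {f : Sp N × Sp N → ℝ}
    (h : MemLp (fun z => deriv (K z) (f z)) (ENNReal.ofReal (p / (p - 1))) volume) :
    fluxLp p K f =ᵐ[volume] fun z => deriv (K z) (f z) := by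
  rw [fluxLp, dif_pos h]
  exact h.coeFn_toLp

variable [hp : Fact (1 < p)]

/-- The flux is dominated by a multiple of |f|^(p-1), and the exponent p/(p-1) turns this into
|f|^p. -/
lemma IsGrowthDensity.memLp_deriv_comp (hK : IsGrowthDensity p c K) {T : ℝ}
    {f : ℝ × (Sp N × Sp N) → ℝ}
    (hf : MemLp f (ENNReal.ofReal p) ((volume.restrict (Ioo 0 T)).prod volume)) :
    MemLp (fun q : ℝ × (Sp N × Sp N) => deriv (K q.2) (f q)) (ENNReal.ofReal (p / (p - 1)))
      ((volume.restrict (Ioo 0 T)).prod volume) := by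
  have hp1 : 0 < p - 1 := sub_pos.2 hp.out
  have h1 := hf.norm_rpow_div (ENNReal.ofReal (p - 1))
  rw [ENNReal.toReal_ofReal hp1.le, ← ENNReal.ofReal_div_of_pos hp1] at h1
  refine h1.of_le_mul (c := c * 2 ^ p) (hK.aestronglyMeasurable_deriv_comp hf.1)
    (ae_of_all _ fun q => ?_)
  rw [Real.norm_of_nonneg (by positivity : 0 ≤ ‖f q‖ ^ (p - 1))]
  exact hK.abs_deriv_le hp.out q.2 (f q)

lemma ae_memLp_section {X : Type*} [MeasurableSpace X] {μ : Measure X} [SFinite μ] {r T : ℝ}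
    (hr : 0 < r) {g : ℝ × X → ℝ}
    (hg : MemLp g (ENNReal.ofReal r) ((volume.restrict (Ioo 0 T)).prod μ)) :
    ∀ᵐ t ∂(volume.restrict (Ioo 0 T)), MemLp (fun x => g (t, x)) (ENNReal.ofReal r) μ := by
  have h1 := (memLp_prod_iff (f := fun t x => g (t, x)) hr hg.1).1 hg
  have h2 : AEMeasurable (fun t => eLpNorm (fun x => g (t, x)) (ENNReal.ofReal r) μ ^ r)
      (volume.restrict (Ioo 0 T)) := by
    simp only [eLpNorm_ofReal_rpow hr]
    exact (hg.1.enorm.pow_const r).lintegral_prod_right'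
  filter_upwards [ae_lt_top' h2 h1.ne, hg.1.prodMk_left] with t ht ht2
  refine ⟨ht2, ?_⟩
  by_contra h
  rw [not_lt, top_le_iff] at h
  rw [h, ENNReal.top_rpow_of_pos hr] at ht
  exact lt_irrefl _ ht

lemma IsGrowthDensity.memLp_fluxLp (hK : IsGrowthDensity p c K) {T : ℝ}
    {f : ℝ → Sp N × Sp N → ℝ}
    (hf : MemLp (fun q : ℝ × (Sp N × Sp N) => f q.1 q.2) (ENNReal.ofReal p)
      ((volume.restrict (Ioo 0 T)).prod volume)) :
    MemLp (fun t => fluxLp p K (f t)) (ENNReal.ofReal (p / (p - 1)))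
      (volume.restrict (Ioo 0 T)) := by
  have hq : 0 < p / (p - 1) := (holderConjugate_div_sub_one hp.out).pos
  have h1 := hK.memLp_deriv_comp hf
  have h2 := ae_memLp_section hq h1
  have hm : AEStronglyMeasurable (fun t => fluxLp p K (f t)) (volume.restrict (Ioo 0 T)) := by
    refine aestronglyMeasurable_curve_Lp hq h1.1.stronglyMeasurable_mk ?_
    filter_upwards [h2, Measure.ae_ae_of_ae_prod h1.1.ae_eq_mk] with t ht1 ht2
    filter_upwards [coeFn_fluxLp ht1, ht2] with z hz1 hz2
    rw [hz1, ← hz2]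
  refine ⟨hm, ?_⟩
  rw [eLpNorm_lt_top_iff_lintegral_rpow_enorm_lt_top (by simpa using hq) ENNReal.ofReal_ne_top,
    ENNReal.toReal_ofReal hq.le]
  refine lt_of_le_of_lt (le_of_eq (lintegral_congr_ae ?_))
    ((memLp_prod_iff (f := fun t z => deriv (K z) (f t z)) hq h1.1).1 h1)
  filter_upwards [h2] with t ht
  rw [fluxLp, dif_pos ht, Lp.enorm_toLp]

end Flux

/-! ### Test functions belong to `L^p(0,T; W^{s,p}(ℝ^N))` -/

/-- The p-th power is |r|^(p-N-sp) near the origin, integrable because s < 1, and |r|^(-N-sp) far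
away, integrable because s > 0. -/
lemma memLp_min_one_div_rpow (hN : 1 ≤ N) {s p : ℝ} (hp : 1 < p) (hs0 : 0 < s) (hs1 : s < 1) :
    MemLp (fun r : Sp N => min 1 ‖r‖ / ‖r‖ ^ ((N : ℝ) / p + s)) (ENNReal.ofReal p) volume := by
  have hp0 : 0 < p := by linarith
  have hm : Measurable fun r : Sp N => min 1 ‖r‖ / ‖r‖ ^ ((N : ℝ) / p + s) := by fun_prop
  have hdim : Module.finrank ℝ (Sp N) = N := by simp
  rw [← integrable_norm_rpow_iff hm.aestronglyMeasurable (by simpa using hp0)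
    ENNReal.ofReal_ne_top, ENNReal.toReal_ofReal hp0.le]
  have hmp : Measurable fun r : Sp N => ‖min 1 ‖r‖ / ‖r‖ ^ ((N : ℝ) / p + s)‖ ^ p := by fun_prop
  have key : ∀ r : Sp N, ‖min 1 ‖r‖ / ‖r‖ ^ ((N : ℝ) / p + s)‖ ^ p
      = min 1 ‖r‖ ^ p / ‖r‖ ^ ((N : ℝ) + s * p) := fun r => by
    have h0 : 0 ≤ min 1 ‖r‖ := le_min zero_le_one (norm_nonneg _)
    rw [Real.norm_of_nonneg (by positivity), Real.div_rpow h0 (by positivity),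
      ← Real.rpow_mul (norm_nonneg _), add_mul, div_mul_cancel₀ _ hp0.ne']
  rw [← integrableOn_univ, ← union_compl_self (Metric.ball (0 : Sp N) 1)]
  refine IntegrableOn.union ?_ ?_
  · refine integrableOn_ball_of_norm_le_rpow (C := 1) (α := N + s * p - p) (by rw [hdim]; exact hN)
      (by rw [hdim]; nlinarith) ((ae_restrict_iff' Metric.isOpen_ball.measurableSet).2
      (ae_of_all _ fun r hr => ?_)) hmp.aestronglyMeasurable
    rw [mem_ball_zero_iff] at hr
    rw [Real.norm_of_nonneg (by positivity), key, min_eq_right hr.le, one_mul]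
    rcases (norm_nonneg r).eq_or_lt with h | h
    · rw [← h, Real.zero_rpow hp0.ne', zero_div]
      positivity
    · rw [← Real.rpow_sub h]
      refine le_of_eq ?_
      congr 1
      ring
  -- The factor comes from 1/|r| ≤ 2/(1+|r|) for |r| ≥ 1.
  · have h1 : Integrable (fun r : Sp N => 2 ^ ((N : ℝ) + s * p) * (1 + ‖r‖) ^ (-((N : ℝ) + s * p)))
        volume := by
      refine (integrable_one_add_norm ?_).const_mul _
      rw [hdim]
      nlinarith
    refine (h1.integrableOn (s := (Metric.ball (0 : Sp N) 1)ᶜ)).mono' hmp.aestronglyMeasurable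
      ((ae_restrict_iff' Metric.isOpen_ball.measurableSet.compl).2 (ae_of_all _ fun r hr => ?_))
    rw [mem_compl_iff, mem_ball_zero_iff, not_lt] at hr
    have hr0 : 0 < ‖r‖ := by linarith
    rw [Real.norm_of_nonneg (by positivity), key, min_eq_left hr, Real.one_rpow, Real.rpow_neg
      (by positivity), ← div_eq_mul_inv, ← Real.div_rpow zero_le_two (by positivity), one_div,
      ← Real.inv_rpow hr0.le]
    refine Real.rpow_le_rpow (by positivity) ?_ (by positivity)
    rw [inv_eq_one_div, div_le_div_iff₀ hr0 (by positivity)]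
    linarith

lemma memLp_indicator_mul_sub {r : ℝ} (hr : 0 < r) {m : Sp N → ℝ} {B : Set (Sp N)}
    (hB : MeasurableSet B) (hB' : volume B ≠ ⊤) (hmm : Measurable m)
    (hm : MemLp m (ENNReal.ofReal r) volume) :
    MemLp (fun z : Sp N × Sp N => B.indicator (fun _ => (1 : ℝ)) z.1 * m (z.1 - z.2))
      (ENNReal.ofReal r) volume := by
  have h1 : Measurable (fun z : Sp N × Sp N => B.indicator (fun _ => (1 : ℝ)) z.1 * m (z.1 - z.2)) :=
    ((measurable_const.indicator hB).comp measurable_fst).mul (hmm.comp (by fun_prop))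
  refine ⟨h1.aestronglyMeasurable, ?_⟩
  have h2 := hm.2
  rw [eLpNorm_lt_top_iff_lintegral_rpow_enorm_lt_top (by simpa using hr) ENNReal.ofReal_ne_top,
    ENNReal.toReal_ofReal hr.le] at h2 ⊢
  rw [Measure.volume_eq_prod, lintegral_prod _ (h1.enorm.pow_const _).aemeasurable]
  have h3 : ∀ x, ∫⁻ y, ‖B.indicator (fun _ => (1 : ℝ)) x * m (x - y)‖ₑ ^ r
      = B.indicator (fun _ => ∫⁻ y, ‖m y‖ₑ ^ r) x := fun x => by
    by_cases hx : x ∈ B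
    · simp only [hx, indicator_of_mem, one_mul]
      exact lintegral_sub_left_eq_self (fun y => ‖m y‖ₑ ^ r) x
    · simp [hx, hr]
  simp only [h3]
  rw [lintegral_indicator_const hB]
  exact ENNReal.mul_lt_top h2 hB'.lt_top

/-- Boundedness and the Lipschitz property give |φ(x) - φ(y)| ≤ max(2M, L) min(1, |x-y|), and the
difference vanishes unless x or y lies in a fixed ball. The kernel in x - y is integrated over that
ball times ℝ^N, once for each variable. -/
lemma IsTestFunction.memLpW (hN : 1 ≤ N) {s p : ℝ} (hp : 1 < p) (hs0 : 0 < s) (hs1 : s < 1)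
    {Ω : Set (Sp N)} {T : ℝ} {φ : ℝ → Sp N → ℝ} (hφ : IsTestFunction Ω T φ) :
    MemLpW s p T φ := by
  have hp0 : 0 < p := by linarith
  obtain ⟨M, hM⟩ := hφ.exists_bound
  obtain ⟨L, hL⟩ := hφ.1.lipschitzWith_of_hasCompactSupport hφ.2.1 (by simp)
  obtain ⟨R, hR⟩ := hφ.2.1.isBounded.subset_ball (0 : ℝ × Sp N)
  have hM0 : 0 ≤ M := (norm_nonneg _).trans (hM (0, 0))
  have hzero : ∀ t x, x ∉ Metric.ball (0 : Sp N) R → φ t x = 0 := by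
    intro t x hx
    by_contra h0
    have h1 : (t, x) ∈ Metric.ball (0 : ℝ × Sp N) R := hR (subset_tsupport _ h0)
    rw [mem_ball_zero_iff, Prod.norm_def] at h1
    exact hx (mem_ball_zero_iff.2 ((le_max_right _ _).trans_lt h1))
  have hφm : AEStronglyMeasurable (fun q : ℝ × Sp N => φ q.1 q.2)
      ((volume.restrict (Ioo 0 T)).prod volume) := hφ.1.continuous.aestronglyMeasurable
  rw [memLpW_iff hp]
  refine ⟨?_, ?_⟩
  · have h1 : MemLp (fun q : ℝ × Sp N => φ q.1 q.2) (ENNReal.ofReal p)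
        ((volume : Measure ℝ).prod volume) :=
      hφ.1.continuous.memLp_of_hasCompactSupport hφ.2.1
    exact h1.mono_measure (Measure.prod_mono Measure.restrict_le_self le_rfl)
  · set m : Sp N → ℝ := fun r => min 1 ‖r‖ / ‖r‖ ^ ((N : ℝ) / p + s) with hm
    have hmm : Measurable m := by fun_prop
    have hm0 : ∀ r, 0 ≤ m r := fun r => by
      have : 0 ≤ min 1 ‖r‖ := le_min zero_le_one (norm_nonneg _)
      positivity
    have hmsymm : ∀ x y : Sp N, m (x - y) = m (y - x) := fun x y => by
      simp only [hm, norm_sub_rev x y]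
    set I : Sp N → ℝ := (Metric.ball (0 : Sp N) R).indicator (fun _ => (1 : ℝ)) with hI
    have hI0 : ∀ x, 0 ≤ I x := fun x => indicator_nonneg (fun _ _ => zero_le_one) x
    have ha : MemLp (fun z : Sp N × Sp N => I z.1 * m (z.1 - z.2)) (ENNReal.ofReal p) volume :=
      memLp_indicator_mul_sub hp0 Metric.isOpen_ball.measurableSet
        Metric.isBounded_ball.measure_lt_top.ne hmm (memLp_min_one_div_rpow hN hp hs0 hs1)
    have hb : MemLp (fun z : Sp N × Sp N => I z.2 * m (z.1 - z.2)) (ENNReal.ofReal p) volume := by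
      have h1 := ha.comp_measurePreserving (Measure.measurePreserving_swap
        (μ := (volume : Measure (Sp N))) (ν := (volume : Measure (Sp N))))
      refine h1.ae_eq (ae_of_all _ fun z => ?_)
      simp only [Function.comp, Prod.fst_swap, Prod.snd_swap, hmsymm]
    have hD := (ha.add hb).comp_snd (volume.restrict (Ioo 0 T))
    refine hD.of_le_mul (c := max (2 * M) L) (aestronglyMeasurable_diffQuot_prod s p hφm)
      (ae_of_all _ fun q => ?_)
    obtain ⟨t, x, y⟩ := q
    have hC0 : 0 ≤ max (2 * M) (L : ℝ) := le_max_of_le_right L.2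
    have h1 : ‖φ t x - φ t y‖ ≤ max (2 * M) L * min 1 ‖x - y‖ := by
      rcases le_total 1 ‖x - y‖ with h | h
      · rw [min_eq_left h, mul_one]
        refine (norm_sub_le _ _).trans (le_max_of_le_left ?_)
        linarith [hM (t, x), hM (t, y)]
      · rw [min_eq_right h]
        have h2 := hL.dist_le_mul (t, x) (t, y)
        rw [Prod.dist_eq, dist_self, max_eq_right dist_nonneg, dist_eq_norm, dist_eq_norm] at h2
        exact h2.trans (mul_le_mul_of_nonneg_right (le_max_right _ _) (norm_nonneg _))
    have h3 : ‖diffQuot s p (φ t) (x, y)‖ ≤ max (2 * M) L * m (x - y) := by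
      have h5 : 0 ≤ ‖x - y‖ ^ ((N : ℝ) / p + s) := by positivity
      change ‖(φ t x - φ t y) / ‖x - y‖ ^ ((N : ℝ) / p + s)‖
        ≤ max (2 * M) L * (min 1 ‖x - y‖ / ‖x - y‖ ^ ((N : ℝ) / p + s))
      rw [norm_div, Real.norm_of_nonneg h5, ← mul_div_assoc]
      exact div_le_div_of_nonneg_right h1 h5
    have h4 : 0 ≤ I x * m (x - y) + I y * m (x - y) :=
      add_nonneg (mul_nonneg (hI0 x) (hm0 _)) (mul_nonneg (hI0 y) (hm0 _))
    change ‖diffQuot s p (φ t) (x, y)‖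
      ≤ max (2 * M) L * ‖I x * m (x - y) + I y * m (x - y)‖
    rw [Real.norm_of_nonneg h4]
    by_cases hx : x ∈ Metric.ball (0 : Sp N) R
    · refine h3.trans (mul_le_mul_of_nonneg_left ?_ hC0)
      have : I x = 1 := by simp only [hI, indicator_of_mem hx]
      rw [this, one_mul]
      exact le_add_of_nonneg_right (mul_nonneg (hI0 y) (hm0 _))
    · by_cases hy : y ∈ Metric.ball (0 : Sp N) R
      · refine h3.trans (mul_le_mul_of_nonneg_left ?_ hC0)
        have : I y = 1 := by simp only [hI, indicator_of_mem hy]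
        rw [this, one_mul]
        exact le_add_of_nonneg_left (mul_nonneg (hI0 x) (hm0 _))
      · rw [diffQuot, hzero t x hx, hzero t y hy]
        simp only [sub_self, zero_div, norm_zero]
        exact mul_nonneg hC0 h4

/-! ### The time derivative and the weak equation -/

section Weak

variable {s p c : ℝ} [hp : Fact (1 < p)] {K : Sp N × Sp N → ℝ → ℝ}

/-- The null set of times does not depend on w, so w = φ(t) may be inserted. -/
lemma IsGrowthDensity.ae_fluxL_apply (hK : IsGrowthDensity p c K) (Ω : Set (Sp N)) {T : ℝ}
    {u : ℝ → Sp N → ℝ} (hu : MemLpW s p T u) :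
    ∀ᵐ t ∂(volume.restrict (Ioo 0 T)), ∀ w : W0 Ω s p,
      fluxL Ω s p (fluxLp p K (diffQuot s p (u t))) w
        = - ∫ z, deriv (K z) (diffQuot s p (u t) z) * diffQuot s p (w : Sp N → ℝ) z := by
  have hq : 0 < p / (p - 1) := (holderConjugate_div_sub_one hp.out).pos
  filter_upwards [ae_memLp_section hq (hK.memLp_deriv_comp ((memLpW_iff hp.out).1 hu).2)]
    with t ht w
  rw [fluxL_apply]
  congr 1
  refine integral_congr_ae ?_
  filter_upwards [coeFn_fluxLp ht] with z hz
  rw [hz]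

lemma IsGrowthDensity.integrable_deriv_mul (hK : IsGrowthDensity p c K) {T : ℝ}
    {f g : ℝ × (Sp N × Sp N) → ℝ}
    (hf : MemLp f (ENNReal.ofReal p) ((volume.restrict (Ioo 0 T)).prod volume))
    (hg : MemLp g (ENNReal.ofReal p) ((volume.restrict (Ioo 0 T)).prod volume)) :
    Integrable (fun q : ℝ × (Sp N × Sp N) => deriv (K q.2) (f q) * g q)
      ((volume.restrict (Ioo 0 T)).prod volume) :=
  (hK.memLp_deriv_comp hf).integrable_mul hg

variable {Ω : Set (Sp N)} [IsFiniteMeasure (volume.restrict Ω)]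
  {H : Sp N → Sp N → ℝ → ℝ} {u₀ : Sp N → ℝ} {u : ℝ → Sp N → ℝ}

/-- Fubini on both sides of the Euler-Lagrange identity separates η from w; the integrability of F
is inherited from the flux through a bounded linear map. -/
lemma IsVariationalSolution.isTimeDeriv (hu : IsVariationalSolution Ω s p H u₀ u)
    (hΩ : MeasurableSet Ω) (hu₀ : IsData Ω s p H u₀) (hK : IsGrowthDensity p c K)
    (hc : 0 ≤ c) (hKH : ∀ᵐ z : Sp N × Sp N, ∀ w : Sp N → ℝ,
      H z.1 z.2 (w z.1 - w z.2) / ‖z.1 - z.2‖ ^ N = K z (diffQuot s p w z)) {T : ℝ}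
    (hT : 0 < T) :
    IsTimeDeriv Ω s p T u fun t => fluxL Ω s p (fluxLp p K (diffQuot s p (u t))) := by
  have huT := hu.memLpW T hT
  have huD := ((memLpW_iff hp.out).1 huT).2
  have hu2 := hu.memLp_two_cylinder hΩ hp.out hu₀ hT
  have hflux := hK.memLp_fluxLp (f := fun t => diffQuot s p (u t)) huD
  refine ⟨hflux.of_enorm_le_mul (c := ‖fluxL Ω s p‖₊)
    ((fluxL Ω s p).continuous.comp_aestronglyMeasurable hflux.1)
    (ae_of_all _ fun t => (fluxL Ω s p).le_opENorm _), fun w hw2 η hη1 hη2 hη3 => ?_⟩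
  have hη : IsTimeTest T η := ⟨hη1, hη2, hη3⟩
  obtain ⟨M, -, hM, hM'⟩ := hη.exists_bound
  have hw : MemW s p (w : Sp N → ℝ) := (Subtype.property w).1
  have hgp : MemLp (fun q : ℝ × (Sp N × Sp N) => η q.1 * diffQuot s p (w : Sp N → ℝ) q.2)
      (ENNReal.ofReal p) ((volume.restrict (Ioo 0 T)).prod volume) :=
    memLp_mul_prod hη.contDiff.continuous.measurable hM (W0.memLp_diffQuot w)
  have hηw' : MemLp (fun q : ℝ × Sp N => deriv η q.1 * (w : Sp N → ℝ) q.2) 2 (cylinder Ω T) :=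
    memLp_mul_prod hη.continuous_deriv.measurable hM' hw2
  have h1 := hu.integral_mul_deriv_eq hΩ hp.out hu₀ hK hc hKH hT hw (Subtype.property w).2 hw2 hη
  rw [integral_prod _ (hK.integrable_deriv_mul huD hgp)] at h1
  have h2 : ∫ q, u q.1 q.2 * (deriv η q.1 * (w : Sp N → ℝ) q.2) ∂(cylinder Ω T)
      = ∫ t in Ioo 0 T, (∫ x in Ω, u t x * (w : Sp N → ℝ) x) * deriv η t := by
    refine (integral_prod (fun q : ℝ × Sp N => u q.1 q.2 * (deriv η q.1 * (w : Sp N → ℝ) q.2))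
      (hu2.integrable_mul hηw')).trans ?_
    refine integral_congr_ae (ae_of_all _ fun t => ?_)
    simp only
    rw [← integral_mul_const]
    refine integral_congr_ae (ae_of_all _ fun x => ?_)
    simp only
    ring
  rw [← h2, h1, ← integral_neg]
  refine integral_congr_ae ?_
  filter_upwards [hK.ae_fluxL_apply Ω huT] with t ht
  rw [ht w, neg_mul, ← integral_mul_const]
  congr 1
  refine integral_congr_ae (ae_of_all _ fun z => ?_)
  simp only
  ring

end Weak

end NonlocalEvolution

end

/-! ### Existence of the time derivative and the weak equation. -/

theorem mainTheorem4 {N : ℕ} (hN : 1 ≤ N) (Ω : Set (NonlocalEvolution.Sp N)) (hΩ : IsOpen Ω)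
    (hΩb : Bornology.IsBounded Ω) (s p A C : ℝ) (hs0 : 0 < s) (hs1 : s < 1) [Fact (1 < p)]
    (hA : 0 < A)
    (H : NonlocalEvolution.Sp N → NonlocalEvolution.Sp N → ℝ → ℝ)
    (hH : NonlocalEvolution.IsAdmissible s p A H)
    (hC1 : ∀ᵐ z : NonlocalEvolution.Sp N × NonlocalEvolution.Sp N, ContDiff ℝ 1 (H z.1 z.2))
    (hupper : ∀ᵐ z : NonlocalEvolution.Sp N × NonlocalEvolution.Sp N, ∀ ξ : ℝ,
      H z.1 z.2 ξ ≤ C * (|ξ| / ‖z.1 - z.2‖ ^ s) ^ p)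
    (u₀ : NonlocalEvolution.Sp N → ℝ) (hu₀ : NonlocalEvolution.IsData Ω s p H u₀)
    (u : ℝ → NonlocalEvolution.Sp N → ℝ)
    (hu : NonlocalEvolution.IsVariationalSolution Ω s p H u₀ u) :
    ∀ T > 0,
      (∃ F : ℝ → StrongDual ℝ (NonlocalEvolution.W0 Ω s p),
        NonlocalEvolution.IsTimeDeriv Ω s p T u F) ∧
      NonlocalEvolution.IsWeakSolution Ω s p H u₀ T u := by
  intro T hT
  have hp : 1 < p := Fact.out
  have hΩm := hΩ.measurableSet
  have hfin : IsFiniteMeasure (volume.restrict Ω) :=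
    isFiniteMeasure_restrict.2 hΩb.measure_lt_top.ne
  obtain ⟨K, hK, hKH, hKH'⟩ :=
    NonlocalEvolution.exists_isGrowthDensity hN hp hA hH hC1 hupper
  have hF := hu.isTimeDeriv hΩm hu₀ hK (abs_nonneg C) hKH hT
  refine ⟨⟨_, hF⟩, hu.memLpW T hT, hu.boundary T hT, hu.continuousInL2 T hT,
    hu.ae_eq_initial hΩm hp hu₀, _, hF, fun τ hτ φ hφ => ?_⟩
  -- The formula for F involves neither T nor τ, so the same F serves on every (0,τ).
  have huτ := hu.memLpW τ hτ.1
  have hi := hK.integrable_deriv_mul ((NonlocalEvolution.memLpW_iff hp).1 huτ).2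
    ((NonlocalEvolution.memLpW_iff hp).1 (hφ.memLpW hN hp hs0 hs1)).2
  have heq : (fun q : ℝ × (NonlocalEvolution.Sp N × NonlocalEvolution.Sp N) =>
      deriv (K q.2) (NonlocalEvolution.diffQuot s p (u q.1) q.2)
        * NonlocalEvolution.diffQuot s p (φ q.1 : NonlocalEvolution.Sp N → ℝ) q.2)
      =ᵐ[(volume.restrict (Ioo 0 τ)).prod volume]
      NonlocalEvolution.weakIntegrand H u (fun t => (φ t : NonlocalEvolution.Sp N → ℝ)) := by
    filter_upwards [NonlocalEvolution.ae_prod_of_ae_snd (ν := volume.restrict (Ioo 0 τ)) hKH']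
      with q hq
    exact (hq (u q.1) (φ q.1)).symm
  have hdual : (fun t => - ∫ z, deriv (K z) (NonlocalEvolution.diffQuot s p (u t) z)
        * NonlocalEvolution.diffQuot s p (φ t : NonlocalEvolution.Sp N → ℝ) z)
      =ᵐ[volume.restrict (Ioo 0 τ)] fun t => NonlocalEvolution.fluxL Ω s p
        (NonlocalEvolution.fluxLp p K (NonlocalEvolution.diffQuot s p (u t))) (φ t) := by
    filter_upwards [hK.ae_fluxL_apply Ω huτ] with t ht
    exact (ht (φ t)).symm
  refine ⟨hi.congr heq, hi.integral_prod_left.neg.congr hdual, ?_⟩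
  -- After Fubini the two terms are opposite by the formula for F.
  rw [← integral_congr_ae heq, ← integral_congr_ae hdual, integral_neg, integral_prod _ hi,
    add_neg_cancel]
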